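/- Let $K$ be a field with a valuation $\mathrm{val}\colon K^*\to\mathbb R$ (and $\mathrm{val}(0)=\infty$), with value group $\Gamma=\mathrm{val}(K^*)$ and residue field $\Bbbk$. Assume that there is a group homomorphism $\gamma\mapsto t^\gamma$ from $\Gamma$ to $K^*$ with $\mathrm{val}(t^\gamma)=\gamma$, and fix one. Let $S=K[x_1,\dots,x_n]$, fix a weight vector $w\in\Gamma^n$ and a monomial term order $\prec$. **Notation.** For $f=\sum_u c_ux^u\in S$ put $\mathrm{trop}(f)(w)=\min\{\mathrm{val}(c_u)+w\cdot u : c_u\ne 0\}$ (with value $\infty$ for $f=0$) and $\mathrm{in}_w(f)=\sum \overline{t^{-\mathrm{val}(c_u)}c_u}\,x^u\in\Bbbk[x_1,\dots,x_n]$, the sum being over the $u$ with $c_u\neq 0$ for which the minimum is attained. For an ideal $I\subseteq S$ let $\mathrm{in}_w(I)=\langle \mathrm{in}_w(f): f\in I\rangle$. A finite set $G\subset S$ is a Gröbner basis for $I$ with respect to $w$ if $\mathrm{in}_w(I)=\langle \mathrm{in}_w(g):g\in G\rangle$. On $\Bbbk[x_1,\dots,x_n]$, $\mathrm{in}_\prec$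 denotes the usual ($\prec$-largest) leading term of a polynomial, and the ideal generated by the leading terms of all elements of an ideal. For $f\neq 0$ let $\mathrm{lm}(f)$ be the monomial occurring in $\mathrm{in}_\prec(\mathrm{in}_w(f))$ and $\mathrm{lc}(f)\in K$ the coefficient of $\mathrm{lm}(f)$ in $f$. The $S$-polynomial is $$S(f,g)=\mathrm{lc}(g)\frac{\mathrm{lcm}(\mathrm{lm}(f),\mathrm{lm}(g))}{\mathrm{lm}(f)}f-\mathrm{lc}(f)\frac{\mathrm{lcm}(\mathrm{lm}(f),\mathrm{lm}(g))}{\mathrm{lm}(g)}g.$$ **Normal form algorithm.** Let $E\colon S\times S\to\mathbb N$. To divide a homogeneous $f$ by a finite set $G$ of nonzero homogeneous polynomials, start with $T=G$, $q_0=f$, $r_0=0$ and $h_{g,0}=0$ for $g\in G$. While $q_j\ne0$: * If no $g\in T$ has $\mathrm{lm}(g)\mid\mathrm{lm}(q_j)$, put $r_{j+1}=r_j+\mathrm{lc}(q_j)\mathrm{lm}(q_j)$, $q_{j+1}=q_j-\mathrm{lc}(q_j)\mathrm{lm}(q_j)$, $h_{g,j+1}=h_{g,j}$ for all $g\in G$,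 and add $q_j$ to $T$. * Otherwise choose $g\in T$ with $\mathrm{lm}(g)\mid\mathrm{lm}(q_j)$ and $E(q_j,g)$ minimal; if $E(q_j,g)>0$ add $q_j$ to $T$. Let $\mathrm{lm}(x^vg)=\mathrm{lm}(q_j)$, $c=\mathrm{lc}(q_j)/\mathrm{lc}(x^vg)$ and $p=q_j-cx^vg$. If $g\in G$, put $q_{j+1}=p$, add $cx^v$ to $h_{g}$, and leave $r$ and the other $h_{g'}$ unchanged. If instead $g=q_m\notin G$ was added at an earlier step $m<j$, put $q_{j+1}=\frac1{1-c}p$, $r_{j+1}=\frac1{1-c}(r_j-c\,r_m)$ and $h_{g',j+1}=\frac1{1-c}(h_{g',j}-c\,h_{g',m})$ for all $g'\in G$. When $q_j=0$, the output $r=r_j$ is a normal form of $f$ with respect to $G$. **Buchberger algorithm.** Given a finite set $F\subset S$ of nonzero homogeneous polynomials, start with $G=F$ and $P=F\times F$. While $P\neq\emptyset$, pick a pair $(g,g')\in P$ and remove it from $P$, compute a normal form $r$ of $S(g,g')$ with respect to $G$, and if $r\ne0$ replace $G$ by $G\cup\{r\}$ and then $P$ by $P\cup\{(r,g):g\in G\}$.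 Return $G$. **Theorem.** 1. For $E(f,g)=|\mathrm{supp}(g)\setminus\mathrm{supp}(f)|$ (the number of monomials of $g$ not occurring in $f$), every execution of the normal form algorithm on homogeneous input (with nonzero divisors) ends after finitely many steps with $q_j=0$. 2. Let $E$ be any function for which every execution of the normal form algorithm on homogeneous input (with nonzero divisors) ends after finitely many steps with $q_j=0$. Then for every finite set $F$ of nonzero homogeneous polynomials, with $I=\langle F\rangle$ and whatever choices are made, the Buchberger algorithm using $E$ stops after finitely many steps with $P=\emptyset$, all normal form computations in it stop after finitely many steps, and the returned set $G$ consists of homogeneous elements of $I$ and satisfies $$\langle \mathrm{in}_\prec(\mathrm{in}_w(g)):g\in G\rangle=\mathrm{in}_\prec(\mathrm{in}_w(I)),\qquad \langle \mathrm{in}_w(g):g\in G\rangle=\mathrm{in}_w(I);$$ in particular $G$ is a Gröbner basis of $I$ with respect to $w$. 3. Let $v_1,\dots,v_m\in K^d$ and $\beta_1,\dots,\beta_m\in\mathbb R$. For every $y\in\mathrm{span}(v_1,\dots,v_m)$ there is $\lambda\in K^m$ with $\sum\lambda_iv_i=y$ that maximizes $\min_i(\mathrm{val}(\lambda_i)+\beta_i)$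 among all such $\lambda$. 4. Let $G$ be a finite set of nonzero homogeneous polynomials and $f\in\langle G\rangle$ homogeneous. Among all representations $f=\sum_{g\in G}h_gg$ with $h_g\in S$ there is one for which $\min_g\mathrm{trop}(h_gg)(w)$ is maximal. -/

import Mathlib

open MvPolynomial

namespace ValuedGroebner

noncomputable section

/-! ## Executions of nondeterministic algorithms -/

/-- Every execution of the transition system `step` that starts in `s₀` is finite, and it can only
stop in a state satisfying `final`. -/
def AlwaysHalts {σ : Type*} (step : σ → σ → Prop) (final : σ → Prop) (s₀ : σ) : Prop :=
  (¬ ∃ run : ℕ → σ, run 0 = s₀ ∧ ∀ k, step (run k) (run (k + 1))) ∧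
    ∀ s, Relation.ReflTransGen step s₀ s → (∃ s', step s s') ∨ final s

/-! ## Valued fields, initial forms and initial ideals -/

section Setting

variable {K : Type*} [Field K] (v : AddValuation K (WithTop ℝ))

/-- The value group `Γ = val(K*)`, a subgroup of `ℝ`. -/
def valueGroup : AddSubgroup ℝ where
  carrier := {x | ∃ a : K, v a = (x : WithTop ℝ)}
  zero_mem' := ⟨1, by simp⟩
  add_mem' := by
    rintro x y ⟨a, ha⟩ ⟨b, hb⟩
    exact ⟨a * b, by rw [v.map_mul, ha, hb, WithTop.coe_add]⟩
  neg_mem' := by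
    rintro x ⟨a, ha⟩
    exact ⟨a⁻¹, by rw [AddValuation.map_inv, ha, WithTop.LinearOrderedAddCommGroup.coe_neg]⟩

/-- The valuation of a nonzero element as an element of the value group. -/
def val (a : K) (ha : a ≠ 0) : valueGroup v :=
  ⟨(v a).untop ((v.ne_top_iff).2 ha), a, (WithTop.coe_untop _ _).symm⟩

/-- The valuation ring `R = {a : val(a) ≥ 0}`. -/
abbrev valuationRing : ValuationSubring K :=
  (AddValuation.toValuation v).valuationSubring

/-- The residue field `R / 𝔪`. -/
abbrev ResidueField : Type _ := IsLocalRing.ResidueField (valuationRing v)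

open scoped Classical in
/-- The image in the residue field of an element of the valuation ring
(`0` is a placeholder outside the valuation ring). -/
def toResidue (a : K) : ResidueField v :=
  if h : a ∈ valuationRing v then IsLocalRing.residue (valuationRing v) ⟨a, h⟩ else 0

variable (φ : Multiplicative (valueGroup v) →* Kˣ) {n : ℕ} (w : Fin n → valueGroup v)

/-- `w · u`. -/
def dot (w : Fin n → valueGroup v) (u : Fin n →₀ ℕ) : ℝ := ∑ i, (w i : ℝ) * (u i : ℝ)

/-- `trop(f)(w) = min (val(c_u) + w · u : c_u ≠ 0)`, which is `∞` for `f = 0`. -/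
def trop (f : MvPolynomial (Fin n) K) : WithTop ℝ :=
  f.support.inf fun u => v (f.coeff u) + (dot v w u : WithTop ℝ)

open scoped Classical in
/-- The residue class of `t^{-val(c)} c`, where `t^γ = φ(γ)`; it is `0` for `c = 0`. -/
def angular (c : K) : ResidueField v :=
  if hc : c = 0 then 0 else toResidue v (φ (Multiplicative.ofAdd (-val v c hc)) * c)

open scoped Classical in
/-- The initial form `in_w(f)`. -/
def inW (f : MvPolynomial (Fin n) K) : MvPolynomial (Fin n) (ResidueField v) :=
  ∑ u ∈ f.support with v (f.coeff u) + (dot v w u : WithTop ℝ) = trop v w f,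
    monomial u (angular v φ (f.coeff u))

/-- The initial ideal `in_w(I) = ⟨in_w(f) : f ∈ I⟩`. -/
def initialIdeal (I : Ideal (MvPolynomial (Fin n) K)) :
    Ideal (MvPolynomial (Fin n) (ResidueField v)) :=
  Ideal.span {p | ∃ f ∈ I, p = inW v φ w f}

/-- The finite set `G` is a Gröbner basis of `I` with respect to `w`:
`in_w(I) = ⟨in_w(g) : g ∈ G⟩`. -/
def IsGroebnerBasis (G : Finset (MvPolynomial (Fin n) K))
    (I : Ideal (MvPolynomial (Fin n) K)) : Prop :=
  initialIdeal v φ w I = Ideal.span {p | ∃ g ∈ G, p = inW v φ w g}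

/-- The initial ideal `in_≺(J)` of usual Gröbner theory, generated by the leading terms of all
elements of `J`. -/
def leadingIdeal {k : Type*} [Field k] (ord : MonomialOrder (Fin n))
    (J : Ideal (MvPolynomial (Fin n) k)) : Ideal (MvPolynomial (Fin n) k) :=
  Ideal.span {p | ∃ q ∈ J, p = ord.leadingTerm q}

/-! ## Leading data with respect to `w` and `≺` -/

variable (ord : MonomialOrder (Fin n))

/-- The exponent vector of the monomial `lm(f)` occurring in `in_≺(in_w(f))`, for `f ≠ 0`. -/
def lmExp (f : MvPolynomial (Fin n) K) : Fin n →₀ ℕ := ord.degree (inW v φ w f)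

/-- `lc(f)`, the coefficient of `lm(f)` in `f`. -/
def lc (f : MvPolynomial (Fin n) K) : K := f.coeff (lmExp v φ w ord f)

/-- The `S`-polynomial of `f` and `g`. -/
def sPoly (f g : MvPolynomial (Fin n) K) : MvPolynomial (Fin n) K :=
  let a := lmExp v φ w ord f
  let b := lmExp v φ w ord g
  monomial (a ⊔ b - a) (lc v φ w ord g) * f - monomial (a ⊔ b - b) (lc v φ w ord f) * g

/-! ## The normal form algorithm -/

/-- A polynomial `q_m` that was added to `T` at an earlier iteration of the normal form algorithm,
together with the values `h_{im}` and `r_m` at that iteration. -/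
structure Snapshot (G : Finset (MvPolynomial (Fin n) K)) where
  q : MvPolynomial (Fin n) K
  h : G → MvPolynomial (Fin n) K
  r : MvPolynomial (Fin n) K

/-- A state of the normal form algorithm for division by `G`. The set `T` of available divisors
consists of `G` and of the polynomials `q_m` recorded in `old`. -/
structure NFState (G : Finset (MvPolynomial (Fin n) K)) where
  old : Set (Snapshot G)
  cur : Snapshot G

/-- Initialization: `T = G`, `q_0 = f`, `h_{i0} = 0`, `r_0 = 0`. -/
def NFState.init (G : Finset (MvPolynomial (Fin n) K)) (f : MvPolynomial (Fin n) K) :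
    NFState G :=
  ⟨∅, ⟨f, 0, 0⟩⟩

/-- The polynomials in `T`. -/
def NFState.T {G : Finset (MvPolynomial (Fin n) K)} (s : NFState G) :
    Set (MvPolynomial (Fin n) K) :=
  ↑G ∪ Snapshot.q '' s.old

/-- The loop has ended: `q_j = 0`. -/
def NFState.Final {G : Finset (MvPolynomial (Fin n) K)} (s : NFState G) : Prop := s.cur.q = 0

/-- The polynomial `g ∈ T` is an admissible choice in the division step: `lm(g)` divides `lm(q_j)`,
and `E(q_j, g)` is minimal among all such `g ∈ T`. -/
def NFState.Choice {G : Finset (MvPolynomial (Fin n) K)}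
    (E : MvPolynomial (Fin n) K → MvPolynomial (Fin n) K → ℕ) (s : NFState G)
    (g : MvPolynomial (Fin n) K) : Prop :=
  g ∈ s.T ∧ lmExp v φ w ord g ≤ lmExp v φ w ord s.cur.q ∧
    ∀ g' ∈ s.T, lmExp v φ w ord g' ≤ lmExp v φ w ord s.cur.q → E s.cur.q g ≤ E s.cur.q g'

open scoped Classical in
/-- The recorded snapshots after a division step by `g`: the current polynomial `q_j` is added
to `T` if `E(q_j, g) > 0`. -/
def NFState.oldAfter {G : Finset (MvPolynomial (Fin n) K)}
    (E : MvPolynomial (Fin n) K → MvPolynomial (Fin n) K → ℕ) (s : NFState G)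
    (g : MvPolynomial (Fin n) K) : Set (Snapshot G) :=
  if 0 < E s.cur.q g then insert s.cur s.old else s.old

/-- The exponent `v` of the monomial `x^v` with `lm(x^v g) = lm(q)`. -/
def quotExp (q g : MvPolynomial (Fin n) K) : Fin n →₀ ℕ := lmExp v φ w ord q - lmExp v φ w ord g

/-- The coefficient `c_v = lc(q) / lc(x^v g)`. -/
def quotCoeff (q g : MvPolynomial (Fin n) K) : K :=
  lc v φ w ord q / lc v φ w ord (monomial (quotExp v φ w ord q g) 1 * g)

open scoped Classical in
/-- One iteration of the loop of the normal form algorithm, with the function `E`. -/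
inductive NFStep (E : MvPolynomial (Fin n) K → MvPolynomial (Fin n) K → ℕ)
    (G : Finset (MvPolynomial (Fin n) K)) : NFState G → NFState G → Prop
  /-- Move to remainder. -/
  | toRemainder (s : NFState G) (hq : s.cur.q ≠ 0)
      (hT : ∀ g ∈ s.T, ¬ lmExp v φ w ord g ≤ lmExp v φ w ord s.cur.q) :
      NFStep E G s
        { old := insert s.cur s.old
          cur :=
            { q := s.cur.q - monomial (lmExp v φ w ord s.cur.q) (lc v φ w ord s.cur.q)
              h := s.cur.h
              r := s.cur.r + monomial (lmExp v φ w ord s.cur.q) (lc v φ w ord s.cur.q) } }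
  /-- Divide by an element of `G`. -/
  | divideGenerator (s : NFState G) (hq : s.cur.q ≠ 0) (g : G)
      (hg : s.Choice v φ w ord E g) :
      NFStep E G s
        { old := s.oldAfter E g
          cur :=
            { q := s.cur.q -
                monomial (quotExp v φ w ord s.cur.q g) (quotCoeff v φ w ord s.cur.q g) * g
              h := Function.update s.cur.h g (s.cur.h g +
                monomial (quotExp v φ w ord s.cur.q g) (quotCoeff v φ w ord s.cur.q g))
              r := s.cur.r } }
  /-- Divide by a polynomial `q_m` added to `T` at an earlier iteration. -/
  | divideOld (s : NFState G) (hq : s.cur.q ≠ 0) (m : Snapshot G) (hm : m ∈ s.old)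
      (hmG : m.q ∉ G) (hg : s.Choice v φ w ord E m.q) :
      NFStep E G s
        { old := s.oldAfter E m.q
          cur :=
            { q := C (1 / (1 - quotCoeff v φ w ord s.cur.q m.q)) * (s.cur.q -
                monomial (quotExp v φ w ord s.cur.q m.q) (quotCoeff v φ w ord s.cur.q m.q) * m.q)
              h := fun i => C (1 / (1 - quotCoeff v φ w ord s.cur.q m.q)) *
                (s.cur.h i - C (quotCoeff v φ w ord s.cur.q m.q) * m.h i)
              r := C (1 / (1 - quotCoeff v φ w ord s.cur.q m.q)) *
                (s.cur.r - C (quotCoeff v φ w ord s.cur.q m.q) * m.r) } }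

/-- `r` is a normal form of `f` with respect to `G`: some completed execution of the normal form
algorithm outputs the remainder `r`. -/
def IsNormalForm (E : MvPolynomial (Fin n) K → MvPolynomial (Fin n) K → ℕ)
    (G : Finset (MvPolynomial (Fin n) K)) (f r : MvPolynomial (Fin n) K) : Prop :=
  ∃ s : NFState G, Relation.ReflTransGen (NFStep v φ w ord E G) (NFState.init G f) s ∧
    s.Final ∧ s.cur.r = r

/-- The function `E(f, g) = |{u : b_u ≠ 0, c_u = 0}|` for `f = ∑ c_u x^u` and `g = ∑ b_u x^u`. -/
def supportEcart (f g : MvPolynomial (Fin n) K) : ℕ := (g.support \ f.support).card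

/-- A finite set of nonzero homogeneous polynomials. -/
def IsHomogeneousInput (F : Finset (MvPolynomial (Fin n) K)) : Prop :=
  ∀ f ∈ F, f ≠ 0 ∧ ∃ d : ℕ, f.IsHomogeneous d

/-- The normal form algorithm with the function `E` halts on every homogeneous input. -/
def EnsuresTermination (E : MvPolynomial (Fin n) K → MvPolynomial (Fin n) K → ℕ) : Prop :=
  ∀ (G : Finset (MvPolynomial (Fin n) K)) (f : MvPolynomial (Fin n) K) (d : ℕ),
    IsHomogeneousInput G → f.IsHomogeneous d →
      AlwaysHalts (NFStep v φ w ord E G) NFState.Final (NFState.init G f)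

/-! ## The Buchberger algorithm -/

/-- A state of the Buchberger algorithm: the current set `G` and the set `P` of pairs that are
still to be considered. -/
structure BState (K : Type*) [Field K] (n : ℕ) where
  G : Finset (MvPolynomial (Fin n) K)
  P : Finset (MvPolynomial (Fin n) K × MvPolynomial (Fin n) K)

/-- Initialization: `G = F` and `P = {(g, g') : g, g' ∈ G}`. -/
def BState.init (F : Finset (MvPolynomial (Fin n) K)) : BState K n := ⟨F, F ×ˢ F⟩

/-- The loop has ended: `P = ∅`. -/
def BState.Final (s : BState K n) : Prop := s.P = ∅

open scoped Classical in
/-- One iteration of the loop of the Buchberger algorithm: some pair is taken out of `P`, and its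
`S`-polynomial is replaced by a normal form `r` with respect to the current `G`. -/
inductive BStep (E : MvPolynomial (Fin n) K → MvPolynomial (Fin n) K → ℕ) :
    BState K n → BState K n → Prop
  | zero (s : BState K n) (p : MvPolynomial (Fin n) K × MvPolynomial (Fin n) K) (hp : p ∈ s.P)
      (hr : IsNormalForm v φ w ord E s.G (sPoly v φ w ord p.1 p.2) 0) :
      BStep E s ⟨s.G, s.P.erase p⟩
  | new (s : BState K n) (p : MvPolynomial (Fin n) K × MvPolynomial (Fin n) K) (hp : p ∈ s.P)
      (r : MvPolynomial (Fin n) K)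
      (hr : IsNormalForm v φ w ord E s.G (sPoly v φ w ord p.1 p.2) r) (hr0 : r ≠ 0) :
      BStep E s ⟨insert r s.G, s.P.erase p ∪ {r} ×ˢ insert r s.G⟩

end Setting

end

end ValuedGroebner

/-!
The leading monomial `lm(f)` of a polynomial over `K` is governed by a single ordered quantity. The
*level* of a term `c x^u` is the pair of `val(c) + w · u` and `u`, compared lexicographically with
`≺` reversed in the second place, and the level of a polynomial is the least level of its terms
(`level`). Then `lm(f)` is the exponent of the unique term of least level (`termLevel_lc`), levels
satisfy the ultrametric inequality, they add up in products with monomials, and subtracting a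
polynomial with the same leading term raises the level (`level_lt_level_sub`).

*Optimal representations.* Let a vector be given as a combination of finitely many vectors over
`K`. A linear relation among the vectors that are used allows one of them to be eliminated without
any loss, provided it is chosen where the relation is most leading. So only combinations of linearly
independent vectors compete for optimality, and there are finitely many of those
(`exists_optimal_coefficients`). Since `G` is homogeneous, representations of a homogeneous `f` may
be projected to those whose terms have the degree of `f`, which form a finite-dimensional problem
(`exists_optimal_multipliers`). With `trop` as the measure of quality, and Gauss's lemma for
`trop`, this gives the optimal representations of the theorem.

*Normal forms.* In the algorithm the levels of the `q_j` increase strictly. When `q_j` is divided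
by an earlier `q_m`, both have the same degree, hence the same leading monomial, so the quotient `c`
of the leading coefficients has positive valuation and `1 - c` is a unit of valuation zero. Hence
`f = ∑ h_g g + r` with no cancellation of leading terms, and no monomial of `r` is divisible by a
leading monomial of `G` (`IsNormalForm.isPartialDivision`). For `E(f, g) = |supp g \ supp f|` every
step either records a pair of support and leading monomial that was not recorded before, of which
there are finitely many in each degree, or shrinks the support of `q_j`.

*Buchberger's criterion.* Real valuations are not well ordered, so one cannot improve
representations until cancellation stops. Instead one starts with a representation of a homogeneous
`f` that is optimal for the level. If its leading terms cancelled, the `S`-polynomials would yield a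
better one (`mem_boundedSpan_of_lt_level`); so `lm(f)` is divisible by some `lm(g)`.

*Initial ideals.* The substitution `x_i ↦ t^{-w_i} x_i` reduces initial forms to reduction modulo
the maximal ideal of the valuation ring, which shows that every nonzero element of `in_w(I)` is the
initial form of an element of `I` (`exists_inW_eq_of_mem_initialIdeal`). Together with the criterion
this gives the leading ideal, and ordinary division over the residue field shows that the `in_w(g)`
generate `in_w(I)`. The main loop of the algorithm stops because the monomial ideals generated by
the `lm(g)` form an ascending chain.
-/

namespace ValuedGroebner

noncomputable section

/-! ### Valuations of coefficients and residues -/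

section Residue

variable {K : Type*} [Field K] (v : AddValuation K (WithTop ℝ))

theorem mem_valuationRing_iff {a : K} : a ∈ valuationRing v ↔ 0 ≤ v a := Iff.rfl

theorem residue_ne_zero_iff (a : valuationRing v) :
    IsLocalRing.residue (valuationRing v) a ≠ 0 ↔ v (a : K) = 0 := by
  rw [IsLocalRing.residue_ne_zero_iff_isUnit]
  constructor
  · rintro ⟨u, rfl⟩
    refine le_antisymm ?_ ((mem_valuationRing_iff v).1 (u : valuationRing v).2)
    have h1 : ((u : valuationRing v) : K) * ((u⁻¹ : (valuationRing v)ˣ) : valuationRing v) = 1 := by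
      exact_mod_cast congrArg Subtype.val u.mul_inv
    have h2 := (mem_valuationRing_iff v).1 ((u⁻¹ : (valuationRing v)ˣ) : valuationRing v).2
    have h3 := congrArg v h1
    rw [v.map_mul, v.map_one] at h3
    calc v ((u : valuationRing v) : K) ≤ _ := le_add_of_nonneg_right h2
      _ = 0 := h3
  · intro h
    have h0 : (a : K) ≠ 0 := by
      rintro h0
      rw [h0, v.map_zero] at h
      exact WithTop.top_ne_zero h
    refine IsUnit.of_mul_eq_one (⟨(a : K)⁻¹, ?_⟩ : valuationRing v) ?_
    · rw [mem_valuationRing_iff, v.map_inv, h, neg_zero]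
    · exact Subtype.ext (mul_inv_cancel₀ h0)

theorem toResidue_eq {a : K} (h : a ∈ valuationRing v) :
    toResidue v a = IsLocalRing.residue (valuationRing v) ⟨a, h⟩ := by
  simp [toResidue, h]

theorem coe_val {a : K} (ha : a ≠ 0) : (((val v a ha : valueGroup v) : ℝ) : WithTop ℝ) = v a :=
  WithTop.coe_untop _ _

theorem exists_real_eq {a : K} (ha : a ≠ 0) : ∃ x : ℝ, v a = x := ⟨_, (coe_val v ha).symm⟩

/-- The homomorphism `φ`, written `γ ↦ t^γ`, splits the valuation. -/
abbrev IsSplitting (φ : Multiplicative (valueGroup v) →* Kˣ) : Prop :=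
  ∀ γ : valueGroup v, v (φ (Multiplicative.ofAdd γ) : K) = ((γ : ℝ) : WithTop ℝ)

variable {v}

theorem angular_ne_zero {φ : Multiplicative (valueGroup v) →* Kˣ}
    (hφ : IsSplitting v φ)
    {c : K} (hc : c ≠ 0) : angular v φ c ≠ 0 := by
  have h : v (φ (Multiplicative.ofAdd (-val v c hc)) * c) = 0 := by
    rw [v.map_mul, hφ, ← coe_val v hc, ← WithTop.coe_add]
    simp
  rw [angular, dif_neg hc, toResidue_eq v ((mem_valuationRing_iff v).2 h.ge)]
  exact (residue_ne_zero_iff v _).2 h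

end Residue

/-! ### Levels of terms and polynomials -/

section Level

variable {K : Type*} [Field K] (v : AddValuation K (WithTop ℝ)) {n : ℕ}
  (w : Fin n → valueGroup v) (ord : MonomialOrder (Fin n))

theorem dot_add (u u' : Fin n →₀ ℕ) : dot v w (u + u') = dot v w u + dot v w u' := by
  simp [dot, mul_add, Finset.sum_add_distrib]

theorem dot_zero : dot v w 0 = 0 := by simp [dot]

/-- The ordered monoid in which levels live: real numbers refined by the opposite of the monomial
order, with `⊤` for the zero polynomial. -/
abbrev Level := WithTop (ℝ ×ₗ ord.synᵒᵈ)

/-- The level of the term `c x^u`: the value `val(c) + w · u`, with ties broken by `≺`, so that a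
term of smaller level is a more leading one. -/
def termLevel (c : K) (u : Fin n →₀ ℕ) : Level ord :=
  (v c).map fun x => toLex (x + dot v w u, OrderDual.toDual (ord.toSyn u))

/-- The level of a polynomial, the smallest level of its terms. It is a refinement of `trop`
that behaves like a valuation. -/
def level (f : MvPolynomial (Fin n) K) : Level ord :=
  f.support.inf fun u => termLevel v w ord (f.coeff u) u

variable {v w ord}

theorem termLevel_coe {c : K} {x : ℝ} (h : v c = x) (u : Fin n →₀ ℕ) :
    termLevel v w ord c u = (toLex (x + dot v w u, OrderDual.toDual (ord.toSyn u)) :) := by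
  rw [termLevel, h, WithTop.map_coe]

@[simp] theorem termLevel_zero (u : Fin n →₀ ℕ) : termLevel v w ord 0 u = ⊤ := by
  rw [termLevel, v.map_zero, WithTop.map_top]

theorem termLevel_eq_top {c : K} {u : Fin n →₀ ℕ} : termLevel v w ord c u = ⊤ ↔ c = 0 := by
  rw [termLevel, WithTop.map_eq_top_iff, v.top_iff]

theorem termLevel_one_zero : termLevel v w ord 1 0 = 0 := by
  rw [termLevel_coe (x := 0) (by simp), dot_zero, add_zero, map_zero]
  rfl

theorem termLevel_strictMono (u : Fin n →₀ ℕ) :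
    StrictMono (WithTop.map fun x : ℝ => toLex (x + dot v w u, OrderDual.toDual (ord.toSyn u))) :=
  StrictMono.withTop_map fun x y h => by
    rw [Prod.Lex.toLex_lt_toLex]
    exact Or.inl (by simpa using h)

theorem termLevel_le_iff {a b : K} {u : Fin n →₀ ℕ} :
    termLevel v w ord a u ≤ termLevel v w ord b u ↔ v a ≤ v b :=
  (termLevel_strictMono u).le_iff_le

theorem termLevel_lt_iff {a b : K} {u : Fin n →₀ ℕ} :
    termLevel v w ord a u < termLevel v w ord b u ↔ v a < v b :=
  (termLevel_strictMono u).lt_iff_lt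

theorem min_le_termLevel_add (a b : K) (u : Fin n →₀ ℕ) :
    min (termLevel v w ord a u) (termLevel v w ord b u) ≤ termLevel v w ord (a + b) u := by
  rw [termLevel, termLevel, ← (termLevel_strictMono u).monotone.map_min]
  exact (termLevel_strictMono u).monotone (v.map_add a b)

theorem termLevel_neg (a : K) (u : Fin n →₀ ℕ) :
    termLevel v w ord (-a) u = termLevel v w ord a u := by
  rw [termLevel, termLevel, v.map_neg]

theorem termLevel_mul (a b : K) (u u' : Fin n →₀ ℕ) :
    termLevel v w ord (a * b) (u + u') = termLevel v w ord a u + termLevel v w ord b u' := by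
  by_cases ha : a = 0
  · simp [ha]
  by_cases hb : b = 0
  · simp [hb]
  obtain ⟨x, hx⟩ := exists_real_eq v ha
  obtain ⟨y, hy⟩ := exists_real_eq v hb
  rw [termLevel_coe hx, termLevel_coe hy,
    termLevel_coe (x := x + y) (by rw [v.map_mul, hx, hy, WithTop.coe_add]), ← WithTop.coe_add,
    ← toLex_add, Prod.mk_add_mk, ← toDual_add, map_add, dot_add, add_add_add_comm]

/-- Terms of equal level have the same exponent and coefficients of equal valuation. -/
theorem termLevel_inj {a b : K} {u u' : Fin n →₀ ℕ} (ha : a ≠ 0)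
    (h : termLevel v w ord a u = termLevel v w ord b u') : u = u' ∧ v a = v b := by
  have hb : b ≠ 0 := by
    rintro rfl
    rw [termLevel_zero] at h
    exact ha (termLevel_eq_top.1 h)
  obtain ⟨x, hx⟩ := exists_real_eq v ha
  obtain ⟨y, hy⟩ := exists_real_eq v hb
  rw [termLevel_coe hx, termLevel_coe hy, WithTop.coe_inj] at h
  have h' := Prod.ext_iff.1 (toLex.injective h)
  have hu : u = u' := ord.toSyn.injective (OrderDual.toDual.injective h'.2)
  subst hu
  exact ⟨rfl, by rw [hx, hy, add_right_cancel h'.1]⟩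

theorem level_le (f : MvPolynomial (Fin n) K) (u : Fin n →₀ ℕ) :
    level v w ord f ≤ termLevel v w ord (f.coeff u) u := by
  by_cases hu : u ∈ f.support
  · exact Finset.inf_le hu
  · rw [notMem_support_iff.1 hu, termLevel_zero]
    exact le_top

theorem le_level_iff {f : MvPolynomial (Fin n) K} {ℓ : Level ord} :
    ℓ ≤ level v w ord f ↔ ∀ u, ℓ ≤ termLevel v w ord (f.coeff u) u :=
  ⟨fun h u => h.trans (level_le f u), fun h => Finset.le_inf fun u _ => h u⟩

theorem lt_level_iff {f : MvPolynomial (Fin n) K} {ℓ : Level ord} (hℓ : ℓ ≠ ⊤) :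
    ℓ < level v w ord f ↔ ∀ u, ℓ < termLevel v w ord (f.coeff u) u :=
  ⟨fun h u => h.trans_le (level_le f u),
    fun h => (Finset.lt_inf_iff (lt_top_iff_ne_top.2 hℓ)).2 fun u _ => h u⟩

theorem level_eq_top {f : MvPolynomial (Fin n) K} : level v w ord f = ⊤ ↔ f = 0 := by
  rw [← top_le_iff, le_level_iff]
  simp only [top_le_iff, termLevel_eq_top]
  exact ⟨fun h => MvPolynomial.ext _ _ h, fun h u => by rw [h, coeff_zero]⟩

@[simp] theorem level_zero : level v w ord (0 : MvPolynomial (Fin n) K) = ⊤ := level_eq_top.2 rfl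

theorem min_le_level_add (f g : MvPolynomial (Fin n) K) :
    min (level v w ord f) (level v w ord g) ≤ level v w ord (f + g) := by
  rw [le_level_iff]
  intro u
  rw [coeff_add]
  exact (min_le_min (level_le f u) (level_le g u)).trans (min_le_termLevel_add _ _ _)

theorem level_neg (f : MvPolynomial (Fin n) K) : level v w ord (-f) = level v w ord f := by
  simp only [level, support_neg, coeff_neg, termLevel_neg]

theorem min_le_level_sub (f g : MvPolynomial (Fin n) K) :
    min (level v w ord f) (level v w ord g) ≤ level v w ord (f - g) := by
  rw [sub_eq_add_neg, ← level_neg g]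
  exact min_le_level_add _ _

theorem level_monomial_mul (e : Fin n →₀ ℕ) (c : K) (f : MvPolynomial (Fin n) K) :
    level v w ord (monomial e c * f) = termLevel v w ord c e + level v w ord f := by
  by_cases hf : f = 0
  · simp [hf]
  apply le_antisymm
  · obtain ⟨u, hu, h⟩ := Finset.exists_mem_eq_inf f.support (support_nonempty.2 hf)
      fun u => termLevel v w ord (f.coeff u) u
    rw [level.eq_1 v w ord f, h, ← termLevel_mul, ← coeff_monomial_mul]
    exact level_le _ _
  · rw [le_level_iff]
    intro u
    rw [coeff_monomial_mul']
    split_ifs with h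
    · nth_rw 2 [← add_tsub_cancel_of_le h]
      rw [termLevel_mul]
      gcongr
      exact level_le _ _
    · simp

theorem level_C_mul (c : K) (f : MvPolynomial (Fin n) K) :
    level v w ord (C c * f) = termLevel v w ord c 0 + level v w ord f :=
  level_monomial_mul 0 c f

theorem level_monomial (e : Fin n →₀ ℕ) (c : K) :
    level v w ord (monomial e c) = termLevel v w ord c e := by
  refine le_antisymm ?_ ?_
  · simpa using level_le (v := v) (w := w) (ord := ord) (monomial e c) e
  · rw [le_level_iff]
    intro u
    rw [coeff_monomial]
    split_ifs with hu
    · rw [hu]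
    · simp

end Level

/-! ### Leading monomials -/

section Leading

variable {K : Type*} [Field K] {v : AddValuation K (WithTop ℝ)} {n : ℕ}
  {w : Fin n → valueGroup v} {ord : MonomialOrder (Fin n)}
  {φ : Multiplicative (valueGroup v) →* Kˣ}

open scoped Classical in
theorem coeff_inW (f : MvPolynomial (Fin n) K) (u : Fin n →₀ ℕ) :
    (inW v φ w f).coeff u =
      if u ∈ f.support ∧ v (f.coeff u) + (dot v w u : WithTop ℝ) = trop v w f then
        angular v φ (f.coeff u) else 0 := by
  rw [inW, coeff_sum]
  simp only [coeff_monomial]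
  rw [Finset.sum_ite_eq']
  simp only [Finset.mem_filter]

theorem trop_le (f : MvPolynomial (Fin n) K) (u : Fin n →₀ ℕ) :
    trop v w f ≤ v (f.coeff u) + (dot v w u : WithTop ℝ) := by
  by_cases hu : u ∈ f.support
  · exact Finset.inf_le hu
  · rw [notMem_support_iff.1 hu, v.map_zero, top_add]
    exact le_top

theorem le_trop_iff {f : MvPolynomial (Fin n) K} {τ : WithTop ℝ} :
    τ ≤ trop v w f ↔ ∀ u, τ ≤ v (f.coeff u) + (dot v w u : WithTop ℝ) :=
  ⟨fun h u => h.trans (trop_le f u), fun h => Finset.le_inf fun u _ => h u⟩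

theorem exists_eq_trop {f : MvPolynomial (Fin n) K} (hf : f ≠ 0) :
    ∃ u ∈ f.support, v (f.coeff u) + (dot v w u : WithTop ℝ) = trop v w f := by
  obtain ⟨u, hu, h⟩ := Finset.exists_mem_eq_inf f.support (support_nonempty.2 hf)
    fun u => v (f.coeff u) + (dot v w u : WithTop ℝ)
  exact ⟨u, hu, h.symm⟩

theorem mem_support_inW (hφ : IsSplitting v φ)
    {f : MvPolynomial (Fin n) K} {u : Fin n →₀ ℕ} :
    u ∈ (inW v φ w f).support ↔
      u ∈ f.support ∧ v (f.coeff u) + (dot v w u : WithTop ℝ) = trop v w f := by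
  rw [mem_support_iff, coeff_inW]
  refine ⟨fun h => ?_, fun h => ?_⟩
  · by_contra h'
    exact h (if_neg h')
  · rw [if_pos h]
    exact angular_ne_zero hφ (mem_support_iff.1 h.1)

theorem inW_zero : inW v φ w (0 : MvPolynomial (Fin n) K) = 0 := by
  simp [inW]

theorem inW_ne_zero (hφ : IsSplitting v φ)
    {f : MvPolynomial (Fin n) K} (hf : f ≠ 0) : inW v φ w f ≠ 0 := by
  obtain ⟨u, hu⟩ := exists_eq_trop (v := v) (w := w) hf
  exact support_nonempty.1 ⟨u, (mem_support_inW hφ).2 hu⟩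

theorem lmExp_mem_support (hφ : IsSplitting v φ)
    {f : MvPolynomial (Fin n) K} (hf : f ≠ 0) : lmExp v φ w ord f ∈ f.support :=
  ((mem_support_inW hφ).1 (ord.degree_mem_support (inW_ne_zero hφ hf))).1

theorem lc_ne_zero (hφ : IsSplitting v φ)
    {f : MvPolynomial (Fin n) K} (hf : f ≠ 0) : lc v φ w ord f ≠ 0 :=
  mem_support_iff.1 (lmExp_mem_support hφ hf)

/-- The leading term of `f` is the term of smallest level. -/
theorem termLevel_lc (hφ : IsSplitting v φ)
    {f : MvPolynomial (Fin n) K} (hf : f ≠ 0) :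
    termLevel v w ord (lc v φ w ord f) (lmExp v φ w ord f) = level v w ord f := by
  refine le_antisymm (Finset.le_inf fun u hu => ?_) (level_le _ _)
  have hm := (mem_support_inW hφ).1 (ord.degree_mem_support (inW_ne_zero (w := w) hφ hf))
  obtain ⟨x, hx⟩ := exists_real_eq v (mem_support_iff.1 hu)
  obtain ⟨y, hy⟩ := exists_real_eq v (mem_support_iff.1 hm.1)
  rw [termLevel_coe hx, termLevel_coe (show v (lc v φ w ord f) = y from hy), WithTop.coe_le_coe,
    Prod.Lex.toLex_le_toLex]
  have h2 := hm.2.trans_le (trop_le f u)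
  rw [hx, hy, ← WithTop.coe_add, ← WithTop.coe_add, WithTop.coe_le_coe] at h2
  rcases h2.lt_or_eq with h | h
  · exact Or.inl h
  · refine Or.inr ⟨h, ?_⟩
    refine OrderDual.toDual_le_toDual.2 (ord.le_degree ((mem_support_inW hφ).2 ⟨hu, ?_⟩))
    rw [← hm.2, hx, hy, ← WithTop.coe_add, ← WithTop.coe_add]
    exact congrArg _ h.symm

theorem lmExp_eq_of_termLevel_eq (hφ : IsSplitting v φ)
    {f : MvPolynomial (Fin n) K} (hf : f ≠ 0) {c : K} {u : Fin n →₀ ℕ}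
    (h : termLevel v w ord c u = level v w ord f) : lmExp v φ w ord f = u :=
  (termLevel_inj (lc_ne_zero hφ hf) ((termLevel_lc hφ hf).trans h.symm)).1

theorem level_lt_of_ne_lmExp (hφ : IsSplitting v φ)
    {f : MvPolynomial (Fin n) K} (hf : f ≠ 0) {u : Fin n →₀ ℕ} (hu : u ≠ lmExp v φ w ord f) :
    level v w ord f < termLevel v w ord (f.coeff u) u :=
  (level_le f u).lt_of_ne fun h => hu (lmExp_eq_of_termLevel_eq hφ hf h.symm).symm

theorem lmExp_monomial_mul (hφ : IsSplitting v φ)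
    {f : MvPolynomial (Fin n) K} (hf : f ≠ 0) {c : K} (hc : c ≠ 0) (e : Fin n →₀ ℕ) :
    lmExp v φ w ord (monomial e c * f) = e + lmExp v φ w ord f := by
  apply lmExp_eq_of_termLevel_eq hφ (mul_ne_zero (monomial_eq_zero.not.2 hc) hf)
    (c := c * lc v φ w ord f)
  rw [termLevel_mul, termLevel_lc hφ hf, level_monomial_mul]

theorem lc_monomial_mul (hφ : IsSplitting v φ)
    {f : MvPolynomial (Fin n) K} (hf : f ≠ 0) {c : K} (hc : c ≠ 0) (e : Fin n →₀ ℕ) :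
    lc v φ w ord (monomial e c * f) = c * lc v φ w ord f := by
  rw [lc, lmExp_monomial_mul hφ hf hc, coeff_monomial_mul, lc]

theorem lmExp_monomial (hφ : IsSplitting v φ)
    {c : K} (hc : c ≠ 0) (e : Fin n →₀ ℕ) : lmExp v φ w ord (monomial e c) = e :=
  lmExp_eq_of_termLevel_eq hφ (monomial_eq_zero.not.2 hc) (level_monomial e c).symm

theorem lc_monomial (hφ : IsSplitting v φ)
    {c : K} (hc : c ≠ 0) (e : Fin n →₀ ℕ) : lc v φ w ord (monomial e c) = c := by
  rw [lc, lmExp_monomial hφ hc, coeff_monomial, if_pos rfl]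

/-- Subtracting a polynomial with the same leading term raises the level. -/
theorem level_lt_level_sub (hφ : IsSplitting v φ)
    {f g : MvPolynomial (Fin n) K} (hf : f ≠ 0) (hg : g ≠ 0)
    (hlm : lmExp v φ w ord f = lmExp v φ w ord g) (hlc : lc v φ w ord f = lc v φ w ord g) :
    level v w ord f < level v w ord (f - g) := by
  have hL : level v w ord f = level v w ord g := by
    rw [← termLevel_lc hφ hf, ← termLevel_lc hφ hg, hlm, hlc]
  rw [lt_level_iff (level_eq_top.not.2 hf)]
  intro u
  by_cases hu : u = lmExp v φ w ord f
  · have : (f - g).coeff u = 0 := by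
      rw [coeff_sub, sub_eq_zero]
      subst hu
      exact hlc.trans (by rw [hlm]; rfl)
    rw [this, termLevel_zero]
    exact lt_top_iff_ne_top.2 (level_eq_top.not.2 hf)
  · rw [coeff_sub, sub_eq_add_neg]
    refine lt_of_lt_of_le (lt_min (level_lt_of_ne_lmExp hφ hf hu) ?_) (min_le_termLevel_add _ _ _)
    rw [termLevel_neg, hL]
    exact level_lt_of_ne_lmExp hφ hg (hlm ▸ hu)

end Leading

/-! ### Optimal coefficient vectors -/

section Optimal

variable {K V ι W : Type*} [Field K] [AddCommGroup V] [Module K V] [Fintype ι]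
  [LinearOrder W] [OrderTop W] {x : ι → V} {ρ : ι → K → W}

open scoped Classical in
/-- Every coefficient vector can be replaced by one with linearly independent support without
lowering its quality: along a linear relation, eliminate the coefficient at an index where the
relation is most leading. -/
theorem exists_linearIndepOn_support (h0 : ∀ i, ρ i 0 = ⊤)
    (hsub : ∀ i a b, min (ρ i a) (ρ i b) ≤ ρ i (a - b))
    (hmul : ∀ i j a b c, ρ i a ≤ ρ j b → ρ i (c * a) ≤ ρ j (c * b)) (c : ι → K) :
    ∃ c' : ι → K, ∑ i, c' i • x i = ∑ i, c i • x i ∧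
      LinearIndepOn K x (↑(Finset.univ.filter fun i => c' i ≠ 0) : Set ι) ∧
      (Finset.univ.inf fun i => ρ i (c i)) ≤ Finset.univ.inf fun i => ρ i (c' i) := by
  induction hk : (Finset.univ.filter fun i => c i ≠ 0).card using Nat.strong_induction_on
    generalizing c with
  | _ k ih =>
  by_cases hli : LinearIndepOn K x (↑(Finset.univ.filter fun i => c i ≠ 0) : Set ι)
  · exact ⟨c, rfl, hli, le_rfl⟩
  rw [not_linearIndepOn_finset_iff] at hli
  obtain ⟨f, hf, j, hj, hfj⟩ := hli
  obtain ⟨a, ha⟩ : ∃ a : ι → K, a = fun i => if c i ≠ 0 then f i else 0 := ⟨_, rfl⟩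
  have hasum : ∑ i, a i • x i = 0 := by
    rw [← hf, Finset.sum_filter]
    refine Finset.sum_congr rfl fun i _ => ?_
    rw [ha]
    by_cases hi : c i = 0 <;> simp [hi]
  have hac : ∀ i, c i = 0 → a i = 0 := fun i hi => by rw [ha]; simp [hi]
  obtain ⟨i₀, hi₀, hmin⟩ := Finset.exists_min_image (Finset.univ.filter fun i => a i ≠ 0)
    (fun i => ρ i (a i)) ⟨j, by
      have := (Finset.mem_filter.1 hj).2
      simp [ha, this, hfj]⟩
  have hai₀ : a i₀ ≠ 0 := (Finset.mem_filter.1 hi₀).2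
  have hci₀ : c i₀ ≠ 0 := fun h => hai₀ (hac _ h)
  have hle : ∀ i, ρ i₀ (c i₀) ≤ ρ i (c i₀ / a i₀ * a i) := by
    intro i
    by_cases hi : a i = 0
    · rw [hi, mul_zero, h0]
      exact le_top
    · conv_lhs => rw [← div_mul_cancel₀ (c i₀) hai₀]
      exact hmul _ _ _ _ _ (hmin i (by simp [hi]))
  obtain ⟨c', hc', hind, hinf⟩ := ih (Finset.univ.filter fun i =>
      c i - c i₀ / a i₀ * a i ≠ 0).card (by
    rw [← hk]
    apply Finset.card_lt_card
    rw [Finset.ssubset_iff_of_subset]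
    · refine ⟨i₀, by simp [hci₀], ?_⟩
      simp [div_mul_cancel₀ _ hai₀]
    · intro i
      simp only [Finset.mem_filter, Finset.mem_univ, true_and]
      intro hi h
      rw [h, hac i h, mul_zero, sub_zero] at hi
      exact hi rfl) (fun i => c i - c i₀ / a i₀ * a i) rfl
  refine ⟨c', hc'.trans ?_, hind, le_trans ?_ hinf⟩
  · simp only [sub_smul, mul_smul, Finset.sum_sub_distrib]
    rw [← Finset.smul_sum, hasum, smul_zero, sub_zero]
  · refine Finset.le_inf fun i _ => le_trans (le_min ?_ ?_) (hsub _ _ _)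
    · exact Finset.inf_le (Finset.mem_univ i)
    · exact (Finset.inf_le (Finset.mem_univ i₀)).trans (hle i)

open scoped Classical in
/-- Among all coefficient vectors representing a given vector, one is optimal: only the finitely
many vectors with linearly independent support compete. -/
theorem exists_optimal_coefficients (h0 : ∀ i, ρ i 0 = ⊤)
    (hsub : ∀ i a b, min (ρ i a) (ρ i b) ≤ ρ i (a - b))
    (hmul : ∀ i j a b c, ρ i a ≤ ρ j b → ρ i (c * a) ≤ ρ j (c * b))
    {y : V} (hy : ∃ c : ι → K, ∑ i, c i • x i = y) :
    ∃ c : ι → K, ∑ i, c i • x i = y ∧ ∀ c' : ι → K, ∑ i, c' i • x i = y →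
      (Finset.univ.inf fun i => ρ i (c' i)) ≤ Finset.univ.inf fun i => ρ i (c i) := by
  let S : Set (ι → K) := {c | ∑ i, c i • x i = y ∧
    LinearIndepOn K x (↑(Finset.univ.filter fun i => c i ≠ 0) : Set ι)}
  have hfin : S.Finite := by
    refine Set.Finite.of_finite_image (f := fun c => Finset.univ.filter fun i => c i ≠ 0)
      (Set.toFinite _) ?_
    rintro c ⟨hc, hci⟩ c' ⟨hc', -⟩ h
    simp only at h
    rw [linearIndepOn_finset_iff] at hci
    have key := hci (c - c') (by
      rw [Finset.sum_filter_of_ne]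
      · simp only [Pi.sub_apply, sub_smul, Finset.sum_sub_distrib, hc, hc', sub_self]
      · intro i _ hi
        by_contra h1
        have h2 : i ∉ Finset.univ.filter fun i => c' i ≠ 0 := by
          rw [← h]
          simp [h1]
        simp only [Finset.mem_filter, Finset.mem_univ, true_and, not_not] at h2
        rw [Pi.sub_apply, h1, h2, sub_zero, zero_smul] at hi
        exact hi rfl)
    funext i
    by_cases hi : i ∈ Finset.univ.filter fun i => c i ≠ 0
    · exact sub_eq_zero.1 (key i hi)
    · have hi' := hi
      rw [h] at hi'
      simp only [Finset.mem_filter, Finset.mem_univ, true_and, not_not] at hi hi'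
      rw [hi, hi']
  obtain ⟨c₁, hc₁⟩ := hy
  obtain ⟨c₂, hc₂, hind₂, -⟩ := exists_linearIndepOn_support (x := x) h0 hsub hmul c₁
  obtain ⟨c, hcS, hmax⟩ := Set.exists_max_image S (fun c => Finset.univ.inf fun i => ρ i (c i)) hfin
    ⟨c₂, hc₂.trans hc₁, hind₂⟩
  refine ⟨c, hcS.1, fun c' hc' => ?_⟩
  obtain ⟨c₃, hc₃, hind₃, hle⟩ := exists_linearIndepOn_support (x := x) h0 hsub hmul c'
  exact hle.trans (hmax c₃ ⟨hc₃.trans hc', hind₃⟩)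

end Optimal

/-! ### Spans of monomial multiples -/

section Span

variable {K : Type*} [Field K] {n : ℕ}

/-- The additive group generated by those monomial multiples `c x^e g`, `g ∈ G`, that satisfy `Q`.
With a lower bound on the level for `Q`, its elements are those with a representation
`∑ h_g g` all of whose terms obey the bound. -/
def boundedSpan (G : Finset (MvPolynomial (Fin n) K)) (Q : MvPolynomial (Fin n) K → Prop) :
    AddSubgroup (MvPolynomial (Fin n) K) :=
  AddSubgroup.closure {p | Q p ∧ ∃ g ∈ G, ∃ e c, p = monomial e c * g}

variable {G G' : Finset (MvPolynomial (Fin n) K)} {Q Q' : MvPolynomial (Fin n) K → Prop}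

theorem monomial_mul_mem_boundedSpan {g : MvPolynomial (Fin n) K} (hg : g ∈ G)
    {e : Fin n →₀ ℕ} {c : K} (h : Q (monomial e c * g)) : monomial e c * g ∈ boundedSpan G Q :=
  AddSubgroup.subset_closure ⟨h, g, hg, e, c, rfl⟩

theorem boundedSpan_mono (hG : G ⊆ G') (hQ : ∀ p, Q p → Q' p) :
    boundedSpan G Q ≤ boundedSpan G' Q' :=
  AddSubgroup.closure_mono fun _ ⟨h, g, hg, h'⟩ => ⟨hQ _ h, g, hG hg, h'⟩

theorem monomial_mul_mem_boundedSpan_of_forall {e : Fin n →₀ ℕ} {c : K}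
    {p : MvPolynomial (Fin n) K} (hp : p ∈ boundedSpan G Q)
    (h : ∀ q, Q q → Q' (monomial e c * q)) : monomial e c * p ∈ boundedSpan G Q' := by
  induction hp using AddSubgroup.closure_induction with
  | mem p hp =>
    obtain ⟨hQ, g, hg, e', c', rfl⟩ := hp
    have := h _ hQ
    rw [← mul_assoc, monomial_mul] at this ⊢
    exact monomial_mul_mem_boundedSpan hg this
  | zero => rw [mul_zero]; exact zero_mem _
  | add p q _ _ hp hq => rw [mul_add]; exact add_mem hp hq
  | neg p _ hp => rw [mul_neg]; exact neg_mem hp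

theorem mem_span_of_mem_boundedSpan {p : MvPolynomial (Fin n) K} (hp : p ∈ boundedSpan G Q) :
    p ∈ Ideal.span (G : Set (MvPolynomial (Fin n) K)) := by
  induction hp using AddSubgroup.closure_induction with
  | mem p hp =>
    obtain ⟨-, g, hg, e, c, rfl⟩ := hp
    exact Ideal.mul_mem_left _ _ (Ideal.subset_span hg)
  | zero => exact zero_mem _
  | add p q _ _ hp hq => exact add_mem hp hq
  | neg p _ hp => exact neg_mem hp

theorem mul_mem_boundedSpan {g : MvPolynomial (Fin n) K} (hg : g ∈ G) (h : MvPolynomial (Fin n) K)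
    (hQ : ∀ e ∈ h.support, Q (monomial e (h.coeff e) * g)) : h * g ∈ boundedSpan G Q := by
  rw [← support_sum_monomial_coeff h, Finset.sum_mul]
  exact sum_mem fun e he => monomial_mul_mem_boundedSpan hg (hQ e he)

theorem exists_sum_eq_of_mem_span {f : MvPolynomial (Fin n) K}
    (hf : f ∈ Ideal.span (G : Set (MvPolynomial (Fin n) K))) :
    ∃ h : G → MvPolynomial (Fin n) K, ∑ g, h g * g = f := by
  rw [← Subtype.range_coe (s := (G : Set (MvPolynomial (Fin n) K)))] at hf
  exact Ideal.mem_span_range_iff_exists_fun.1 hf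

theorem mem_boundedSpan_of_mem_span {f : MvPolynomial (Fin n) K}
    (hf : f ∈ Ideal.span (G : Set (MvPolynomial (Fin n) K))) :
    f ∈ boundedSpan G fun _ => True := by
  obtain ⟨h, rfl⟩ := exists_sum_eq_of_mem_span hf
  exact sum_mem fun g _ => mul_mem_boundedSpan g.2 _ fun _ _ => trivial

theorem boundedSpan_subset {M : AddSubgroup (MvPolynomial (Fin n) K)}
    (h : ∀ g ∈ G, ∀ e c, Q (monomial e c * g) → monomial e c * g ∈ M) : boundedSpan G Q ≤ M :=
  (AddSubgroup.closure_le _).2 fun _ ⟨hQ, g, hg, e, c, hp⟩ => by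
    subst hp
    exact h g hg e c hQ

open scoped Classical in
/-- The pairs `(g, e)` with `g ∈ G` for which `x^e g` has degree `d`. -/
def multipliers (G : Finset (MvPolynomial (Fin n) K)) (d : ℕ) :
    Finset (MvPolynomial (Fin n) K × (Fin n →₀ ℕ)) :=
  (G ×ˢ (Finsupp.finite_of_degree_le d).toFinset).filter fun p => p.2.degree + p.1.totalDegree = d

theorem mem_multipliers {d : ℕ} {p : MvPolynomial (Fin n) K × (Fin n →₀ ℕ)} :
    p ∈ multipliers G d ↔ p.1 ∈ G ∧ p.2.degree + p.1.totalDegree = d := by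
  simp only [multipliers, Finset.mem_filter, Finset.mem_product, Set.Finite.mem_toFinset,
    Set.mem_ofPred_eq]
  exact ⟨fun h => ⟨h.1.1, h.2⟩, fun h => ⟨⟨h.1, h.2 ▸ Nat.le_add_right _ _⟩, h.2⟩⟩

theorem isHomogeneous_totalDegree (hG : IsHomogeneousInput G) {g : MvPolynomial (Fin n) K}
    (hg : g ∈ G) : g.IsHomogeneous g.totalDegree := by
  obtain ⟨h0, d, hd⟩ := hG g hg
  rwa [hd.totalDegree h0]

/-- The component of degree `d` of an element of a bounded span is a combination, subject to the
same bound, of the multiples of degree `d`. -/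
theorem homogeneousComponent_eq_sum_multipliers (hG : IsHomogeneousInput G) (d : ℕ) (hQ0 : Q 0)
    (hQadd : ∀ p q, Q p → Q q → Q (p + q)) (hQneg : ∀ p, Q p → Q (-p))
    {p : MvPolynomial (Fin n) K} (hp : p ∈ boundedSpan G Q) :
    ∃ c : multipliers G d → K,
      ∑ i, c i • (monomial i.1.2 1 * i.1.1) = homogeneousComponent d p ∧
        ∀ i, Q (c i • (monomial i.1.2 1 * i.1.1)) := by
  classical
  induction hp using AddSubgroup.closure_induction with
  | mem p hp =>
    obtain ⟨hQ, g, hg, e, c, rfl⟩ := hp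
    have hhom := (isHomogeneous_monomial c (rfl : e.degree = e.degree)).mul
      (isHomogeneous_totalDegree hG hg)
    rw [homogeneousComponent_of_mem ((mem_homogeneousSubmodule _ _).2 hhom)]
    split_ifs with hd
    · have hmem : (g, e) ∈ multipliers G d := mem_multipliers.2 ⟨hg, hd.symm⟩
      refine ⟨Pi.single ⟨(g, e), hmem⟩ c, ?_, fun i => ?_⟩
      · rw [Finset.sum_eq_single ⟨(g, e), hmem⟩]
        · rw [Pi.single_eq_same, ← smul_mul_assoc, smul_monomial, smul_eq_mul, mul_one]
        · intro i _ hi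
          rw [Pi.single_eq_of_ne hi, zero_smul]
        · simp
      · by_cases hi : i = ⟨(g, e), hmem⟩
        · rw [hi, Pi.single_eq_same, ← smul_mul_assoc, smul_monomial, smul_eq_mul, mul_one]
          exact hQ
        · rw [Pi.single_eq_of_ne hi, zero_smul]
          exact hQ0
    · exact ⟨0, by simp, fun i => by simpa using hQ0⟩
  | zero => exact ⟨0, by simp, fun i => by simpa using hQ0⟩
  | add p q _ _ hp hq =>
    obtain ⟨c, hc, hcQ⟩ := hp
    obtain ⟨c', hc', hcQ'⟩ := hq
    refine ⟨c + c', ?_, fun i => ?_⟩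
    · simp only [Pi.add_apply, add_smul, Finset.sum_add_distrib, hc, hc', map_add]
    · rw [Pi.add_apply, add_smul]
      exact hQadd _ _ (hcQ i) (hcQ' i)
  | neg p _ hp =>
    obtain ⟨c, hc, hcQ⟩ := hp
    refine ⟨-c, ?_, fun i => ?_⟩
    · simp only [Pi.neg_apply, neg_smul, Finset.sum_neg_distrib, hc, map_neg]
    · rw [Pi.neg_apply, neg_smul]
      exact hQneg _ (hcQ i)

/-- A homogeneous element of `⟨G⟩` has a representation by monomial multiples of elements of `G`
of its own degree that is optimal, among all representations, for a nonarchimedean size. -/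
theorem exists_optimal_multipliers {W : Type*} [LinearOrder W] [OrderTop W]
    {size : MvPolynomial (Fin n) K → W} (h0 : size 0 = ⊤)
    (hsub : ∀ p q, min (size p) (size q) ≤ size (p - q))
    (hmul : ∀ (c : K) p q, size p ≤ size q → size (c • p) ≤ size (c • q))
    (hG : IsHomogeneousInput G) {f : MvPolynomial (Fin n) K} {d : ℕ} (hf : f.IsHomogeneous d)
    (hfG : f ∈ Ideal.span (G : Set (MvPolynomial (Fin n) K))) :
    ∃ c : multipliers G d → K, ∑ i, c i • (monomial i.1.2 1 * i.1.1) = f ∧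
      (∀ ℓ, f ∈ boundedSpan G (fun p => ℓ ≤ size p) →
        ∀ i, ℓ ≤ size (c i • (monomial i.1.2 1 * i.1.1))) ∧
      (∀ ℓ ≠ ⊤, f ∈ boundedSpan G (fun p => ℓ < size p) →
        ∀ i, ℓ < size (c i • (monomial i.1.2 1 * i.1.1))) := by
  have hneg : ∀ p, size p ≤ size (-p) := fun p => by
    simpa [h0] using hsub 0 p
  have hadd : ∀ p q, min (size p) (size q) ≤ size (p + q) := fun p q => by
    rw [← sub_neg_eq_add]
    exact (min_le_min_left _ (hneg q)).trans (hsub _ _)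
  have hcomp : homogeneousComponent d f = f := homogeneousComponent_eq_self hf
  obtain ⟨c, hc, hopt⟩ := exists_optimal_coefficients (K := K)
    (V := MvPolynomial (Fin n) K) (ι := multipliers G d)
    (x := fun i : multipliers G d => monomial i.1.2 (1 : K) * i.1.1)
    (ρ := fun i a => size (a • (monomial i.1.2 (1 : K) * i.1.1)))
    (fun i => by rw [zero_smul, h0]) (fun i a b => by rw [sub_smul]; exact hsub _ _)
    (fun i j a b c h => by rw [mul_smul, mul_smul]; exact hmul _ _ _ h) (y := f) (by
      obtain ⟨c, hc, -⟩ := homogeneousComponent_eq_sum_multipliers (Q := fun _ => True) hG d trivial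
        (fun _ _ _ _ => trivial) (fun _ _ => trivial) (mem_boundedSpan_of_mem_span hfG)
      exact ⟨c, hc.trans hcomp⟩)
  refine ⟨c, hc, fun ℓ hℓ i => ?_, fun ℓ htop hℓ i => ?_⟩
  · obtain ⟨c', hc', hQ⟩ := homogeneousComponent_eq_sum_multipliers hG d (by rw [h0]; exact le_top)
      (fun p q hp hq => (le_min hp hq).trans (hadd p q)) (fun p hp => hp.trans (hneg p)) hℓ
    exact ((Finset.le_inf fun i _ => hQ i).trans (hopt c' (hc'.trans hcomp))).trans
      (Finset.inf_le (Finset.mem_univ i))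
  · have htop' := lt_top_iff_ne_top.2 htop
    obtain ⟨c', hc', hQ⟩ := homogeneousComponent_eq_sum_multipliers hG d (by rw [h0]; exact htop')
      (fun p q hp hq => (lt_min hp hq).trans_le (hadd p q)) (fun p hp => hp.trans_le (hneg p)) hℓ
    exact (((Finset.lt_inf_iff htop').2 fun i _ => hQ i).trans_le
      (hopt c' (hc'.trans hcomp))).trans_le (Finset.inf_le (Finset.mem_univ i))

end Span

/-! ### The tropical polynomial as a Gauss valuation -/

section Trop

variable {K : Type*} [Field K] {v : AddValuation K (WithTop ℝ)} {n : ℕ}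
  {w : Fin n → valueGroup v} {ord : MonomialOrder (Fin n)}
  {φ : Multiplicative (valueGroup v) →* Kˣ}

/-- The real part of a level. -/
def realPart (ord : MonomialOrder (Fin n)) : Level ord → WithTop ℝ :=
  WithTop.map fun p => (ofLex p).1

theorem realPart_mono : Monotone (realPart ord) :=
  Monotone.withTop_map fun p q h => by
    rcases Prod.Lex.le_iff.1 h with h | h
    exacts [h.le, h.1.le]

theorem realPart_add (a b : Level ord) :
    realPart ord (a + b) = realPart ord a + realPart ord b := by
  cases a <;> cases b <;> rfl

theorem realPart_termLevel (c : K) (u : Fin n →₀ ℕ) :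
    realPart ord (termLevel v w ord c u) = v c + (dot v w u : WithTop ℝ) := by
  by_cases hc : c = 0
  · rw [hc, termLevel_zero, v.map_zero]
    rfl
  · obtain ⟨x, hx⟩ := exists_real_eq v hc
    rw [termLevel_coe hx, hx]
    rfl

theorem realPart_level (f : MvPolynomial (Fin n) K) :
    realPart ord (level v w ord f) = trop v w f := by
  rw [level, Finset.apply_inf_eq_inf_comp (realPart ord) (fun x y => realPart_mono.map_min) rfl,
    trop]
  exact Finset.inf_congr rfl fun u _ => realPart_termLevel _ _

theorem trop_monomial_mul (ord : MonomialOrder (Fin n)) (e : Fin n →₀ ℕ) (c : K)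
    (f : MvPolynomial (Fin n) K) :
    trop v w (monomial e c * f) = v c + (dot v w e : WithTop ℝ) + trop v w f := by
  rw [← realPart_level (ord := ord), level_monomial_mul, realPart_add, realPart_level,
    realPart_termLevel]

theorem trop_zero : trop v w (0 : MvPolynomial (Fin n) K) = ⊤ := by simp [trop]

theorem min_le_trop_sub (p q : MvPolynomial (Fin n) K) :
    min (trop v w p) (trop v w q) ≤ trop v w (p - q) := by
  rw [le_trop_iff]
  intro u
  refine (min_le_min (trop_le p u) (trop_le q u)).trans ?_
  rw [coeff_sub, min_add_add_right]
  gcongr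
  exact v.map_sub _ _

theorem min_le_trop_add (p q : MvPolynomial (Fin n) K) :
    min (trop v w p) (trop v w q) ≤ trop v w (p + q) := by
  rw [le_trop_iff]
  intro u
  refine (min_le_min (trop_le p u) (trop_le q u)).trans ?_
  rw [coeff_add, min_add_add_right]
  gcongr
  exact v.map_add _ _

theorem le_trop_sum {ι : Type*} {s : Finset ι} {p : ι → MvPolynomial (Fin n) K} {τ : WithTop ℝ}
    (h : ∀ i ∈ s, τ ≤ trop v w (p i)) : τ ≤ trop v w (∑ i ∈ s, p i) :=
  Finset.sum_induction p (fun q => τ ≤ trop v w q)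
    (fun _ _ ha hb => (le_min ha hb).trans (min_le_trop_add _ _)) (trop_zero.ge.trans' le_top) h

/-- The coefficient of the product of the leading monomials of `f` and `g` in `f g` is dominated
by the product of the leading coefficients. -/
theorem valuation_coeff_mul_lmExp (hφ : IsSplitting v φ)
    {f g : MvPolynomial (Fin n) K} (hf : f ≠ 0) (hg : g ≠ 0) :
    v ((f * g).coeff (lmExp v φ w ord f + lmExp v φ w ord g)) =
      v (lc v φ w ord f * lc v φ w ord g) := by
  classical
  rw [coeff_mul, ← Finset.add_sum_erase (a := (lmExp v φ w ord f, lmExp v φ w ord g)) _ _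
    (Finset.HasAntidiagonal.mem_antidiagonal.2 rfl)]
  refine v.map_add_eq_of_lt_left (v.map_lt_sum ?_ ?_)
  · exact v.ne_top_iff.2 (mul_ne_zero (lc_ne_zero hφ hf) (lc_ne_zero hφ hg))
  rintro ⟨a, b⟩ hab
  obtain ⟨hne, hsum⟩ := Finset.mem_erase.1 hab
  rw [Finset.HasAntidiagonal.mem_antidiagonal] at hsum
  have ha : a ≠ lmExp v φ w ord f := by
    rintro rfl
    exact hne (Prod.ext rfl (add_left_cancel hsum))
  have hb : b ≠ lmExp v φ w ord g := by
    rintro rfl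
    exact hne (Prod.ext (add_right_cancel hsum) rfl)
  change v (lc v φ w ord f * lc v φ w ord g) < _
  rw [← termLevel_lt_iff (w := w) (ord := ord) (u := lmExp v φ w ord f + lmExp v φ w ord g),
    termLevel_mul, termLevel_lc hφ hf, termLevel_lc hφ hg, ← hsum, termLevel_mul]
  exact WithTop.add_lt_add (level_lt_of_ne_lmExp hφ hf ha) (level_lt_of_ne_lmExp hφ hg hb)

/-- The inequality of Gauss's lemma that is not clear from the ultrametric inequality. -/
theorem trop_mul_le (ord : MonomialOrder (Fin n)) (hφ : IsSplitting v φ)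
    (f g : MvPolynomial (Fin n) K) : trop v w (f * g) ≤ trop v w f + trop v w g := by
  by_cases hf : f = 0
  · simp [hf, trop_zero]
  by_cases hg : g = 0
  · simp [hg, trop_zero]
  refine (trop_le _ (lmExp v φ w ord f + lmExp v φ w ord g)).trans (le_of_eq ?_)
  rw [valuation_coeff_mul_lmExp hφ hf hg, ← realPart_termLevel (ord := ord), termLevel_mul,
    termLevel_lc hφ hf, termLevel_lc hφ hg, realPart_add, realPart_level, realPart_level]

theorem trop_mul_le_trop_monomial_mul (ord : MonomialOrder (Fin n)) (hφ : IsSplitting v φ)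
    (h g : MvPolynomial (Fin n) K) (e : Fin n →₀ ℕ) :
    trop v w (h * g) ≤ trop v w (monomial e (h.coeff e) * g) := by
  rw [trop_monomial_mul ord]
  refine (trop_mul_le ord hφ h g).trans ?_
  gcongr
  exact trop_le _ _

end Trop

/-! ### Existence of optimal coefficients and representations -/

section OptimalRepresentation

variable {K : Type*} [Field K] {v : AddValuation K (WithTop ℝ)}

theorem exists_optimal_of_mem_span {m d : ℕ} (x : Fin m → Fin d → K) (β : Fin m → ℝ)
    {y : Fin d → K} (hy : y ∈ Submodule.span K (Set.range x)) :
    ∃ c : Fin m → K, ∑ i, c i • x i = y ∧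
      ∀ c' : Fin m → K, ∑ i, c' i • x i = y →
        (Finset.univ.inf fun i => v (c' i) + (β i : WithTop ℝ)) ≤
          Finset.univ.inf fun i => v (c i) + (β i : WithTop ℝ) := by
  refine exists_optimal_coefficients (ρ := fun i a => v a + (β i : WithTop ℝ)) (fun i => by simp)
    (fun i a b => ?_) (fun i j a b c h => ?_) ((Submodule.mem_span_range_iff_exists_fun K).1 hy)
  · rw [min_add_add_right]
    gcongr
    exact v.map_sub _ _
  · rw [v.map_mul, v.map_mul, add_assoc, add_assoc]
    gcongr

theorem exists_optimal_representation {n : ℕ} {w : Fin n → valueGroup v}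
    (ord : MonomialOrder (Fin n)) {φ : Multiplicative (valueGroup v) →* Kˣ}
    (hφ : IsSplitting v φ)
    {G : Finset (MvPolynomial (Fin n) K)} {f : MvPolynomial (Fin n) K} {d : ℕ}
    (hG : IsHomogeneousInput G) (hf : f.IsHomogeneous d)
    (hfG : f ∈ Ideal.span (G : Set (MvPolynomial (Fin n) K))) :
    ∃ h : G → MvPolynomial (Fin n) K, ∑ g, h g * g = f ∧
      ∀ h' : G → MvPolynomial (Fin n) K, ∑ g, h' g * g = f →
        (Finset.univ.inf fun g => trop v w (h' g * g)) ≤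
          Finset.univ.inf fun g => trop v w (h g * g) := by
  classical
  obtain ⟨c, hc, hopt, -⟩ := exists_optimal_multipliers (size := trop v w) trop_zero
    min_le_trop_sub (fun c p q h => by
      rw [← C_mul', ← C_mul', ← monomial_zero', trop_monomial_mul ord, trop_monomial_mul ord]
      gcongr) hG hf hfG
  let h : G → MvPolynomial (Fin n) K := fun g =>
    ∑ i : multipliers G d with i.1.1 = g.1, c i • monomial i.1.2 1
  have hh : ∀ g : G, h g * g =
      ∑ i : multipliers G d with i.1.1 = g.1, c i • (monomial i.1.2 1 * i.1.1) := by
    intro g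
    rw [Finset.sum_mul]
    refine Finset.sum_congr rfl fun i hi => ?_
    rw [(Finset.mem_filter.1 hi).2, smul_mul_assoc]
  refine ⟨h, ?_, fun h' hh' => Finset.le_inf fun g _ => ?_⟩
  · rw [← hc, ← Finset.sum_fiberwise_of_maps_to (s := Finset.univ) (t := Finset.univ)
      (g := fun i : multipliers G d => (⟨i.1.1, (mem_multipliers.1 i.2).1⟩ : G))
      (fun _ _ => Finset.mem_univ _)]
    refine Finset.sum_congr rfl fun g _ => ?_
    rw [hh]
    refine Finset.sum_congr ?_ fun _ _ => rfl
    ext i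
    simp [Subtype.ext_iff]
  · rw [hh]
    refine le_trop_sum fun i _ => hopt _ ?_ i
    rw [← hh']
    refine sum_mem fun g _ => mul_mem_boundedSpan g.2 _ fun e _ => ?_
    exact (Finset.inf_le (Finset.mem_univ g)).trans (trop_mul_le_trop_monomial_mul ord hφ _ _ _)

end OptimalRepresentation

/-! ### Halting of nondeterministic algorithms -/

section Halting

variable {σ α : Type*} {step : σ → σ → Prop} {final : σ → Prop} {s₀ : σ}

/-- An invariant along which a well-founded measure decreases proves that all executions halt. -/
theorem alwaysHalts_of_measure (Inv : σ → Prop) (h₀ : Inv s₀)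
    (hInv : ∀ s s', Inv s → step s s' → Inv s') {r : α → α → Prop} (hr : WellFounded r)
    (μ : σ → α) (hμ : ∀ s s', Inv s → step s s' → r (μ s') (μ s))
    (hprogress : ∀ s, Inv s → (∃ s', step s s') ∨ final s) : AlwaysHalts step final s₀ := by
  refine ⟨?_, fun s hs => hprogress s ?_⟩
  · rintro ⟨run, h0, hrun⟩
    have hI : ∀ k, Inv (run k) := fun k => by
      induction k with
      | zero => rwa [h0]
      | succ k ih => exact hInv _ _ ih (hrun k)
    have : IsWellFounded α r := ⟨hr⟩
    obtain ⟨k, hk⟩ := WellFounded.not_rel_apply_succ (r := r) fun k => μ (run k)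
    exact hk (hμ _ _ (hI k) (hrun k))
  · induction hs with
    | refl => exact h₀
    | tail _ hst ih => exact hInv _ _ ih hst

theorem AlwaysHalts.exists_final (h : AlwaysHalts step final s₀) :
    ∃ s, Relation.ReflTransGen step s₀ s ∧ final s := by
  by_contra! hno
  have hnext : ∀ s : {s // Relation.ReflTransGen step s₀ s},
      ∃ s' : {s // Relation.ReflTransGen step s₀ s}, step s s' := fun s =>
    ((h.2 s s.2).resolve_right (hno s s.2)).elim fun s' hs' => ⟨⟨s', s.2.tail hs'⟩, hs'⟩
  choose next hstep using hnext
  exact h.1 ⟨fun k => (next^[k] ⟨s₀, .refl⟩ : {s // Relation.ReflTransGen step s₀ s}), rfl,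
    fun k => by
      dsimp only
      rw [Function.iterate_succ_apply']
      exact hstep _⟩

end Halting

/-! ### The normal form algorithm -/

section NormalForm

variable {K : Type*} [Field K] {v : AddValuation K (WithTop ℝ)} {n : ℕ}
  {w : Fin n → valueGroup v} {ord : MonomialOrder (Fin n)}
  {φ : Multiplicative (valueGroup v) →* Kˣ}
  {E : MvPolynomial (Fin n) K → MvPolynomial (Fin n) K → ℕ}
  {G : Finset (MvPolynomial (Fin n) K)} {f : MvPolynomial (Fin n) K} {d : ℕ}

theorem degree_eq_of_mem_support (hf : f.IsHomogeneous d) {u : Fin n →₀ ℕ} (hu : u ∈ f.support) :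
    u.degree = d := by
  by_contra h
  exact mem_support_iff.1 hu (hf.coeff_eq_zero h)

theorem eq_of_le_of_degree_eq {a b : Fin n →₀ ℕ} (h : a ≤ b) (hd : a.degree = b.degree) :
    a = b := by
  have h1 := congrArg Finsupp.degree (add_tsub_cancel_of_le h)
  rw [map_add, hd] at h1
  have h2 : b - a = 0 := (Finsupp.degree_eq_zero_iff _).1 (by omega)
  rw [← add_tsub_cancel_of_le h, h2, add_zero]

/-- The multiple of `g` that is subtracted from `q` in a division step. -/
def reducer (v : AddValuation K (WithTop ℝ)) (φ : Multiplicative (valueGroup v) →* Kˣ)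
    (w : Fin n → valueGroup v) (ord : MonomialOrder (Fin n)) (q g : MvPolynomial (Fin n) K) :
    MvPolynomial (Fin n) K :=
  monomial (quotExp v φ w ord q g) (quotCoeff v φ w ord q g) * g

section Reducer

variable {q g : MvPolynomial (Fin n) K}

theorem quotCoeff_eq (hφ : IsSplitting v φ) (hg : g ≠ 0) :
    quotCoeff v φ w ord q g = lc v φ w ord q / lc v φ w ord g := by
  rw [quotCoeff, lc_monomial_mul hφ hg one_ne_zero, one_mul]

theorem quotCoeff_ne_zero (hφ : IsSplitting v φ) (hq : q ≠ 0) (hg : g ≠ 0) :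
    quotCoeff v φ w ord q g ≠ 0 := by
  rw [quotCoeff_eq hφ hg]
  exact div_ne_zero (lc_ne_zero hφ hq) (lc_ne_zero hφ hg)

theorem reducer_ne_zero (hφ : IsSplitting v φ) (hq : q ≠ 0) (hg : g ≠ 0) :
    reducer v φ w ord q g ≠ 0 :=
  mul_ne_zero (monomial_eq_zero.not.2 (quotCoeff_ne_zero hφ hq hg)) hg

theorem lmExp_reducer (hφ : IsSplitting v φ) (hq : q ≠ 0) (hg : g ≠ 0)
    (hle : lmExp v φ w ord g ≤ lmExp v φ w ord q) :
    lmExp v φ w ord (reducer v φ w ord q g) = lmExp v φ w ord q := by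
  rw [reducer, lmExp_monomial_mul hφ hg (quotCoeff_ne_zero hφ hq hg), quotExp,
    tsub_add_cancel_of_le hle]

theorem lc_reducer (hφ : IsSplitting v φ) (hq : q ≠ 0) (hg : g ≠ 0) :
    lc v φ w ord (reducer v φ w ord q g) = lc v φ w ord q := by
  rw [reducer, lc_monomial_mul hφ hg (quotCoeff_ne_zero hφ hq hg), quotCoeff_eq hφ hg,
    div_mul_cancel₀ _ (lc_ne_zero hφ hg)]

theorem level_reducer (hφ : IsSplitting v φ) (hq : q ≠ 0) (hg : g ≠ 0)
    (hle : lmExp v φ w ord g ≤ lmExp v φ w ord q) :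
    level v w ord (reducer v φ w ord q g) = level v w ord q := by
  rw [← termLevel_lc hφ hq, ← termLevel_lc hφ (reducer_ne_zero hφ hq hg),
    lmExp_reducer hφ hq hg hle, lc_reducer hφ hq hg]

theorem level_lt_level_sub_reducer (hφ : IsSplitting v φ) (hq : q ≠ 0) (hg : g ≠ 0)
    (hle : lmExp v φ w ord g ≤ lmExp v φ w ord q) :
    level v w ord q < level v w ord (q - reducer v φ w ord q g) :=
  level_lt_level_sub hφ hq (reducer_ne_zero hφ hq hg) (lmExp_reducer hφ hq hg hle).symm
    (lc_reducer hφ hq hg).symm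

theorem isHomogeneous_reducer (hφ : IsSplitting v φ) (hq : q ≠ 0) (hg : g ≠ 0)
    (hle : lmExp v φ w ord g ≤ lmExp v φ w ord q) (hqd : q.IsHomogeneous d) {d' : ℕ}
    (hgd : g.IsHomogeneous d') : (reducer v φ w ord q g).IsHomogeneous d := by
  have h := (isHomogeneous_monomial (quotCoeff v φ w ord q g)
    (rfl : (quotExp v φ w ord q g).degree = _)).mul hgd
  rwa [← degree_eq_of_mem_support hgd (lmExp_mem_support (ord := ord) hφ hg), ← map_add, quotExp,
    tsub_add_cancel_of_le hle, degree_eq_of_mem_support hqd (lmExp_mem_support hφ hq)] at h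

theorem quotExp_eq_zero (hle : lmExp v φ w ord g ≤ lmExp v φ w ord q)
    (hd : (lmExp v φ w ord g).degree = (lmExp v φ w ord q).degree) :
    quotExp v φ w ord q g = 0 := by
  rw [quotExp, eq_of_le_of_degree_eq hle hd, tsub_self]

theorem reducer_eq_C_mul (h : quotExp v φ w ord q g = 0) :
    reducer v φ w ord q g = C (quotCoeff v φ w ord q g) * g := by
  rw [reducer, h, monomial_zero']

end Reducer

theorem termLevel_eq_zero {c : K} (hc : v c = 0) : termLevel v w ord c 0 = 0 := by
  rw [← termLevel_one_zero (v := v) (w := w) (ord := ord), termLevel, termLevel, hc, v.map_one]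

theorem termLevel_nonneg {c : K} (hc : 0 ≤ v c) : 0 ≤ termLevel v w ord c 0 := by
  rw [← termLevel_one_zero (v := v) (w := w) (ord := ord), termLevel_le_iff, v.map_one]
  exact hc

/-- A coefficient relating a polynomial to one of strictly larger level has positive valuation. -/
theorem valuation_pos_of_level_lt {c : K} {p : MvPolynomial (Fin n) K}
    (h : level v w ord p < level v w ord (C c * p)) : 0 < v c := by
  by_contra hc
  refine h.not_ge ?_
  rw [level_C_mul]
  refine add_le_of_nonpos_left ?_
  rw [← termLevel_one_zero (v := v) (w := w) (ord := ord), termLevel_le_iff, v.map_one]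
  exact not_lt.1 hc

/-- What holds for the data `q_j`, `r_j` of every iteration when dividing the homogeneous
polynomial `f` by `G`; the coefficients `h_j` enter through `f - q_j - r_j = ∑ h_{g,j} g`. -/
structure IsPartialDivision (v : AddValuation K (WithTop ℝ))
    (φ : Multiplicative (valueGroup v) →* Kˣ) (w : Fin n → valueGroup v)
    (ord : MonomialOrder (Fin n)) (G : Finset (MvPolynomial (Fin n) K))
    (f : MvPolynomial (Fin n) K) (d : ℕ) (q r : MvPolynomial (Fin n) K) : Prop where
  hom_q : q.IsHomogeneous d
  hom_r : r.IsHomogeneous d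
  level_q : level v w ord f ≤ level v w ord q
  level_r : level v w ord f ≤ level v w ord r
  mem : f - q - r ∈ boundedSpan G fun p => level v w ord f ≤ level v w ord p
  irreducible : ∀ u ∈ r.support, ∀ g ∈ G, ¬ lmExp v φ w ord g ≤ u

/-- The invariant of the normal form algorithm: levels increase strictly. -/
structure NFInvariant (v : AddValuation K (WithTop ℝ))
    (φ : Multiplicative (valueGroup v) →* Kˣ) (w : Fin n → valueGroup v)
    (ord : MonomialOrder (Fin n)) (G : Finset (MvPolynomial (Fin n) K))
    (f : MvPolynomial (Fin n) K) (d : ℕ) (s : NFState G) : Prop where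
  partialDivision : ∀ x ∈ insert s.cur s.old, IsPartialDivision v φ w ord G f d x.q x.r
  ne_zero : ∀ m ∈ s.old, m.q ≠ 0
  level_lt : ∀ m ∈ s.old, level v w ord m.q < level v w ord s.cur.q

theorem NFInvariant.cur {s : NFState G} (h : NFInvariant v φ w ord G f d s) :
    IsPartialDivision v φ w ord G f d s.cur.q s.cur.r :=
  h.partialDivision _ (Set.mem_insert _ _)

theorem NFInvariant.init (hf : f.IsHomogeneous d) :
    NFInvariant v φ w ord G f d (NFState.init G f) where
  partialDivision := by
    rintro x (rfl | hx)
    · refine ⟨hf, isHomogeneous_zero _ _ _, le_rfl, ?_, ?_, ?_⟩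
      · simp [NFState.init]
      · simp only [NFState.init, sub_self]
        exact zero_mem _
      · simp [NFState.init]
    · exact hx.elim
  ne_zero := fun _ h => h.elim
  level_lt := fun _ h => h.elim

/-- A step that raises the level of `q_j` preserves the invariant if the new data form a partial
division. -/
theorem NFInvariant.next {s s' : NFState G} (h : NFInvariant v φ w ord G f d s)
    (hq : s.cur.q ≠ 0) (hold : s'.old ⊆ insert s.cur s.old)
    (hcur : IsPartialDivision v φ w ord G f d s'.cur.q s'.cur.r)
    (hlt : level v w ord s.cur.q < level v w ord s'.cur.q) :
    NFInvariant v φ w ord G f d s' where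
  partialDivision := by
    rintro x (rfl | hx)
    · exact hcur
    · exact h.partialDivision x (hold hx)
  ne_zero := by
    intro m hm
    rcases hold hm with rfl | hm
    exacts [hq, h.ne_zero m hm]
  level_lt := by
    intro m hm
    rcases hold hm with rfl | hm
    exacts [hlt, (h.level_lt m hm).trans hlt]

theorem oldAfter_subset (s : NFState G) (g : MvPolynomial (Fin n) K) :
    s.oldAfter E g ⊆ insert s.cur s.old := by
  rw [NFState.oldAfter]
  split_ifs
  exacts [subset_rfl, Set.subset_insert _ _]

theorem NFInvariant.step (hφ : IsSplitting v φ)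
    (hG : IsHomogeneousInput G) {s s' : NFState G} (h : NFInvariant v φ w ord G f d s)
    (hs : NFStep v φ w ord E G s s') : NFInvariant v φ w ord G f d s' := by
  have hc := h.cur
  cases hs with
  | toRemainder hq hT =>
    have hl := lc_ne_zero (ord := ord) (w := w) hφ hq
    have hlt := level_lt_level_sub (ord := ord) (w := w) hφ hq (monomial_eq_zero.not.2 hl)
      (lmExp_monomial hφ hl _).symm (lc_monomial hφ hl _).symm
    have hhom := isHomogeneous_monomial (lc v φ w ord s.cur.q)
      (degree_eq_of_mem_support hc.hom_q (lmExp_mem_support (w := w) (ord := ord) hφ hq))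
    refine h.next hq subset_rfl ⟨hc.hom_q.sub hhom, hc.hom_r.add hhom,
      hc.level_q.trans hlt.le, ?_, ?_, ?_⟩ hlt
    · refine (le_min hc.level_r ?_).trans (min_le_level_add _ _)
      rw [level_monomial, termLevel_lc hφ hq]
      exact hc.level_q
    · convert hc.mem using 1
      dsimp only
      ring
    · intro u hu g hg hle
      rcases Finset.mem_union.1 (support_add hu) with hu | hu
      · exact hc.irreducible u hu g hg hle
      · rw [Finset.mem_singleton.1 (support_monomial_subset hu)] at hle
        exact hT g (Or.inl hg) hle
  | divideGenerator hq g hg =>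
    have hg0 := (hG g g.2).1
    obtain ⟨d', hd'⟩ := (hG g g.2).2
    have hlt := level_lt_level_sub_reducer hφ hq hg0 hg.2.1
    refine h.next hq (oldAfter_subset _ _) ⟨hc.hom_q.sub
      (isHomogeneous_reducer hφ hq hg0 hg.2.1 hc.hom_q hd'), hc.hom_r,
      hc.level_q.trans hlt.le, hc.level_r, ?_, hc.irreducible⟩ hlt
    have : reducer v φ w ord s.cur.q g ∈ boundedSpan G fun p => level v w ord f ≤ level v w ord p :=
      monomial_mul_mem_boundedSpan g.2
        (hc.level_q.trans (level_reducer hφ hq hg0 hg.2.1).ge)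
    convert add_mem hc.mem this using 1
    dsimp only [reducer]
    ring
  | divideOld hq m hm hmG hg =>
    have hmc := h.partialDivision m (Set.mem_insert_of_mem _ hm)
    have hm0 := h.ne_zero m hm
    have hlt := level_lt_level_sub_reducer hφ hq hm0 hg.2.1
    have hlev := level_reducer hφ hq hm0 hg.2.1
    -- `q_m` and `q_j` have the same degree, so the leading monomials agree
    have he : quotExp v φ w ord s.cur.q m.q = 0 := quotExp_eq_zero hg.2.1 (by
      rw [degree_eq_of_mem_support hmc.hom_q (lmExp_mem_support hφ hm0),
        degree_eq_of_mem_support hc.hom_q (lmExp_mem_support hφ hq)])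
    have hred := reducer_eq_C_mul he
    have hred' : monomial (quotExp v φ w ord s.cur.q m.q) (quotCoeff v φ w ord s.cur.q m.q) * m.q
      = reducer v φ w ord s.cur.q m.q := rfl
    rw [hred'] at *
    -- `c` has positive valuation because `q_m` has smaller level than `q_j`; thus `1 - c` is a unit
    have hpos : 0 < v (quotCoeff v φ w ord s.cur.q m.q) := by
      refine valuation_pos_of_level_lt (w := w) (ord := ord) (p := m.q) ?_
      rw [← hred, hlev]
      exact h.level_lt m hm
    have hhom := isHomogeneous_reducer hφ hq hm0 hg.2.1 hc.hom_q hmc.hom_q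
    generalize hcq : quotCoeff v φ w ord s.cur.q m.q = c at *
    have hv1 : v (1 - c) = 0 := by
      rw [v.map_sub_eq_of_lt_left (by rwa [v.map_one]), v.map_one]
    have h1c : 1 - c ≠ 0 := v.ne_top_iff.1 (by rw [hv1]; exact WithTop.zero_ne_top)
    have hva : v (1 / (1 - c)) = 0 := by rw [one_div, v.map_inv, hv1, neg_zero]
    have hac : C (1 / (1 - c)) * (1 - C c) = (1 : MvPolynomial (Fin n) K) := by
      rw [← C_1, ← C_sub, ← C_mul, one_div_mul_cancel h1c]
    generalize 1 / (1 - c) = a at *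
    have hlevC : ∀ p : MvPolynomial (Fin n) K, level v w ord (C a * p) = level v w ord p := by
      intro p
      rw [level_C_mul, termLevel_eq_zero hva, zero_add]
    have hleC : ∀ p : MvPolynomial (Fin n) K, level v w ord p ≤ level v w ord (C c * p) := by
      intro p
      rw [level_C_mul]
      exact le_add_of_nonneg_left (termLevel_nonneg hpos.le)
    refine h.next hq (oldAfter_subset _ _) ⟨?_, ?_, ?_, ?_, ?_, ?_⟩ ?_ <;> dsimp only
    · exact (hc.hom_q.sub hhom).C_mul _
    · exact (hc.hom_r.sub (hmc.hom_r.C_mul _)).C_mul _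
    · rw [hlevC]
      exact hc.level_q.trans hlt.le
    · rw [hlevC]
      exact (le_min hc.level_r (hmc.level_r.trans (hleC _))).trans (min_le_level_sub _ _)
    · have h1 : C c * (f - m.q - m.r) ∈
          boundedSpan G fun p => level v w ord f ≤ level v w ord p := by
        rw [← monomial_zero']
        exact monomial_mul_mem_boundedSpan_of_forall hmc.mem fun p hp => hp.trans (hleC p)
      have h2 := monomial_mul_mem_boundedSpan_of_forall (e := 0) (c := a)
        (Q' := fun p => level v w ord f ≤ level v w ord p) (sub_mem hc.mem h1)
        fun p hp => hp.trans (hlevC p).ge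
      rw [monomial_zero'] at h2
      convert h2 using 1
      rw [hred]
      linear_combination (-f) * hac
    · intro u hu g hg hle
      rw [mem_support_iff, coeff_C_mul, coeff_sub, coeff_C_mul] at hu
      by_cases h1 : s.cur.r.coeff u = 0
      · by_cases h2 : m.r.coeff u = 0
        · simp [h1, h2] at hu
        · exact hmc.irreducible u (mem_support_iff.2 h2) g hg hle
      · exact hc.irreducible u (mem_support_iff.2 h1) g hg hle
    · rw [hlevC]
      exact hlt

theorem NFInvariant.of_reflTransGen (hφ : IsSplitting v φ)
    (hG : IsHomogeneousInput G) (hf : f.IsHomogeneous d) {s : NFState G}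
    (hs : Relation.ReflTransGen (NFStep v φ w ord E G) (NFState.init G f) s) :
    NFInvariant v φ w ord G f d s := by
  induction hs with
  | refl => exact .init hf
  | tail _ hst ih => exact ih.step hφ hG hst

/-- A normal form `r` of `f` satisfies `f = ∑ h_g g + r` without cancellation of leading terms. -/
theorem IsNormalForm.isPartialDivision (hφ : IsSplitting v φ)
    (hG : IsHomogeneousInput G) (hf : f.IsHomogeneous d) {r : MvPolynomial (Fin n) K}
    (hr : IsNormalForm v φ w ord E G f r) : IsPartialDivision v φ w ord G f d 0 r := by
  obtain ⟨s, hs, hfin, rfl⟩ := hr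
  have h := (NFInvariant.of_reflTransGen hφ hG hf hs).cur
  rwa [show s.cur.q = 0 from hfin] at h

theorem NFState.exists_step_or_final (s : NFState G) :
    (∃ s', NFStep v φ w ord E G s s') ∨ s.Final := by
  by_cases hq : s.cur.q = 0
  · exact Or.inr hq
  left
  by_cases hT : ∀ g ∈ s.T, ¬ lmExp v φ w ord g ≤ lmExp v φ w ord s.cur.q
  · exact ⟨_, .toRemainder s hq hT⟩
  · push Not at hT
    obtain ⟨g, ⟨hgT, hg⟩, hmin⟩ := (measure (E s.cur.q)).wf.has_min
      {g | g ∈ s.T ∧ lmExp v φ w ord g ≤ lmExp v φ w ord s.cur.q} hT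
    have hch : s.Choice v φ w ord E g := ⟨hgT, hg, fun g' h1 h2 => not_lt.1 (hmin g' ⟨h1, h2⟩)⟩
    by_cases hgG : g ∈ G
    · exact ⟨_, .divideGenerator s hq ⟨g, hgG⟩ hch⟩
    · rcases hgT with h | ⟨m, hm, rfl⟩
      · exact absurd h hgG
      · exact ⟨_, .divideOld s hq m hm hgG hch⟩

/-! ### Termination of the normal form algorithm -/

/-- The support of a polynomial together with its leading exponent; homogeneous polynomials of a
given degree have only finitely many types. -/
def leadType (v : AddValuation K (WithTop ℝ)) (φ : Multiplicative (valueGroup v) →* Kˣ)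
    (w : Fin n → valueGroup v) (ord : MonomialOrder (Fin n)) (q : MvPolynomial (Fin n) K) :
    Finset (Fin n →₀ ℕ) × (Fin n →₀ ℕ) := (q.support, lmExp v φ w ord q)

open scoped Classical in
/-- The types of polynomials of degree `d` that do not occur among the recorded `q_m`. -/
def missingTypes (v : AddValuation K (WithTop ℝ)) (φ : Multiplicative (valueGroup v) →* Kˣ)
    (w : Fin n → valueGroup v) (ord : MonomialOrder (Fin n)) (d : ℕ) (s : NFState G) :
    Finset (Finset (Fin n →₀ ℕ) × (Fin n →₀ ℕ)) :=
  ((Finsupp.finite_of_degree_eq d).toFinset.powerset ×ˢ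
    (Finsupp.finite_of_degree_eq d).toFinset).filter
      fun x => ∀ m ∈ s.old, leadType v φ w ord m.q ≠ x

theorem mem_missingTypes {s : NFState G} {x : Finset (Fin n →₀ ℕ) × (Fin n →₀ ℕ)} :
    x ∈ missingTypes v φ w ord d s ↔ ((∀ u ∈ x.1, u.degree = d) ∧ x.2.degree = d) ∧
      ∀ m ∈ s.old, leadType v φ w ord m.q ≠ x := by
  classical
  rw [missingTypes, Finset.mem_filter, Finset.mem_product, Finset.mem_powerset,
    Finset.subset_iff]
  simp only [Set.Finite.mem_toFinset, Set.mem_ofPred_eq]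

theorem card_missingTypes_lt (hφ : IsSplitting v φ) {s s' : NFState G}
    (hq : s.cur.q ≠ 0) (hqd : s.cur.q.IsHomogeneous d) (hs' : s'.old = insert s.cur s.old)
    (hnew : ∀ m ∈ s.old, leadType v φ w ord m.q ≠ leadType v φ w ord s.cur.q) :
    (missingTypes v φ w ord d s').card < (missingTypes v φ w ord d s).card := by
  apply Finset.card_lt_card
  rw [Finset.ssubset_iff_of_subset]
  · refine ⟨leadType v φ w ord s.cur.q, ?_, ?_⟩
    · exact mem_missingTypes.2 ⟨⟨fun u hu => degree_eq_of_mem_support hqd hu,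
        degree_eq_of_mem_support hqd (lmExp_mem_support hφ hq)⟩, hnew⟩
    · rw [mem_missingTypes, hs']
      exact fun h => h.2 _ (Set.mem_insert _ _) rfl
  · intro x hx
    rw [mem_missingTypes, hs'] at hx
    exact mem_missingTypes.2 ⟨hx.1, fun m hm => hx.2 m (Set.mem_insert_of_mem _ hm)⟩

theorem supportEcart_eq_zero {f g : MvPolynomial (Fin n) K} :
    supportEcart f g = 0 ↔ g.support ⊆ f.support := by
  rw [supportEcart, Finset.card_eq_zero, Finset.sdiff_eq_empty_iff_subset]

/-- Reducing homogeneous `q` by `g` of écart zero removes a monomial from the support. -/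
theorem card_support_sub_reducer_lt (hφ : IsSplitting v φ) {q g : MvPolynomial (Fin n) K}
    (hq : q ≠ 0) (hg : g ≠ 0) (hqd : q.IsHomogeneous d)
    (hle : lmExp v φ w ord g ≤ lmExp v φ w ord q) (hE : supportEcart q g = 0) :
    (q - reducer v φ w ord q g).support.card < q.support.card := by
  classical
  rw [supportEcart_eq_zero] at hE
  have he := quotExp_eq_zero hle (by
    rw [degree_eq_of_mem_support hqd (hE (lmExp_mem_support hφ hg)),
      degree_eq_of_mem_support hqd (lmExp_mem_support hφ hq)])
  apply Finset.card_lt_card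
  rw [Finset.ssubset_iff_of_subset]
  · refine ⟨lmExp v φ w ord q, lmExp_mem_support hφ hq, ?_⟩
    have h := lc_reducer (w := w) (ord := ord) hφ hq hg
    rw [lc, lmExp_reducer hφ hq hg hle] at h
    rw [notMem_support_iff, coeff_sub, h, lc, sub_self]
  · refine (support_sub _ _ _).trans (Finset.union_subset subset_rfl ?_)
    rw [reducer_eq_C_mul he, C_mul']
    exact support_smul.trans hE

/-- A step by a divisor of positive écart, or a move to the remainder, records a new type. The
other steps shrink the support of `q_j`. -/
theorem ensuresTermination_supportEcart (hφ : IsSplitting v φ) :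
    EnsuresTermination v φ w ord supportEcart := by
  intro G f d hG hf
  refine alwaysHalts_of_measure (NFInvariant v φ w ord G f d) (.init hf)
    (fun s s' h hs => h.step hφ hG hs)
    (r := Prod.Lex (· < ·) (· < ·)) (WellFounded.prod_lex wellFounded_lt wellFounded_lt)
    (fun s => ((missingTypes v φ w ord d s).card, s.cur.q.support.card)) ?_
    (fun s _ => s.exists_step_or_final)
  intro s s' h hs
  -- a divisor of écart zero is available as soon as the type of `q_j` has occurred before
  have hknown : ∀ m ∈ s.old, leadType v φ w ord m.q = leadType v φ w ord s.cur.q →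
      m.q ∈ s.T ∧ lmExp v φ w ord m.q ≤ lmExp v φ w ord s.cur.q ∧ supportEcart s.cur.q m.q = 0 :=
    fun m hm hmt => ⟨Or.inr ⟨m, hm, rfl⟩, (Prod.ext_iff.1 hmt).2.le,
      supportEcart_eq_zero.2 (Prod.ext_iff.1 hmt).1.subset⟩
  have hdiv : ∀ g, s.cur.q ≠ 0 → g ≠ 0 → s.Choice v φ w ord supportEcart g →
      s'.old = s.oldAfter supportEcart g →
      s'.cur.q.support ⊆ (s.cur.q - reducer v φ w ord s.cur.q g).support →
      Prod.Lex (· < ·) (· < ·)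
        ((missingTypes v φ w ord d s').card, s'.cur.q.support.card)
        ((missingTypes v φ w ord d s).card, s.cur.q.support.card) := by
    intro g hq hg0 hg hold hsupp
    by_cases hE : 0 < supportEcart s.cur.q g
    · rw [NFState.oldAfter, if_pos hE] at hold
      refine Prod.Lex.left _ _ (card_missingTypes_lt hφ hq h.cur.hom_q hold fun m hm hmt => ?_)
      obtain ⟨h1, h2, h3⟩ := hknown m hm hmt
      exact hE.not_ge ((hg.2.2 _ h1 h2).trans h3.le)
    · rw [NFState.oldAfter, if_neg hE] at hold
      have : missingTypes v φ w ord d s' = missingTypes v φ w ord d s := by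
        rw [missingTypes, missingTypes, hold]
      rw [this]
      exact Prod.Lex.right _ ((Finset.card_le_card hsupp).trans_lt
        (card_support_sub_reducer_lt hφ hq hg0 h.cur.hom_q hg.2.1 (by omega)))
  cases hs with
  | toRemainder hq hT =>
    exact Prod.Lex.left _ _ (card_missingTypes_lt hφ hq h.cur.hom_q rfl fun m hm hmt =>
      hT _ (hknown m hm hmt).1 (hknown m hm hmt).2.1)
  | divideGenerator hq g hg => exact hdiv g hq (hG g g.2).1 hg rfl subset_rfl
  | divideOld hq m hm hmG hg =>
    refine hdiv m.q hq (h.ne_zero m hm) hg rfl ?_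
    dsimp only
    rw [C_mul']
    exact support_smul

end NormalForm

/-! ### Buchberger's criterion -/

section Criterion

variable {K : Type*} [Field K] {v : AddValuation K (WithTop ℝ)} {n : ℕ}
  {w : Fin n → valueGroup v} {ord : MonomialOrder (Fin n)}
  {φ : Multiplicative (valueGroup v) →* Kˣ}
  {G : Finset (MvPolynomial (Fin n) K)} {f g : MvPolynomial (Fin n) K} {d : ℕ}

/-- The leading terms of the two multiples of `f` and `g` cancel in the `S`-polynomial. -/
theorem level_lt_level_sPoly (hφ : IsSplitting v φ) (hf : f ≠ 0) (hg : g ≠ 0) :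
    level v w ord (monomial (lmExp v φ w ord f ⊔ lmExp v φ w ord g - lmExp v φ w ord f)
      (lc v φ w ord g) * f) < level v w ord (sPoly v φ w ord f g) := by
  have hlf := lc_ne_zero (w := w) (ord := ord) hφ hf
  have hlg := lc_ne_zero (w := w) (ord := ord) hφ hg
  refine level_lt_level_sub hφ (mul_ne_zero (monomial_eq_zero.not.2 hlg) hf)
    (mul_ne_zero (monomial_eq_zero.not.2 hlf) hg) ?_ ?_
  · rw [lmExp_monomial_mul hφ hf hlg, lmExp_monomial_mul hφ hg hlf,
      tsub_add_cancel_of_le le_sup_left, tsub_add_cancel_of_le le_sup_right]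
  · rw [lc_monomial_mul hφ hf hlg, lc_monomial_mul hφ hg hlf, mul_comm]

theorem sPoly_swap : sPoly v φ w ord g f = -sPoly v φ w ord f g := by
  simp only [sPoly, sup_comm (lmExp v φ w ord g)]
  ring

theorem isHomogeneous_sPoly (hφ : IsSplitting v φ) (hf : f ≠ 0) (hg : g ≠ 0)
    {d d' : ℕ} (hfd : f.IsHomogeneous d) (hgd : g.IsHomogeneous d') :
    (sPoly v φ w ord f g).IsHomogeneous (lmExp v φ w ord f ⊔ lmExp v φ w ord g).degree := by
  have key : ∀ {p : MvPolynomial (Fin n) K} {k : ℕ} {u : Fin n →₀ ℕ} (c : K), p ≠ 0 →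
      p.IsHomogeneous k → lmExp v φ w ord p ≤ u →
      (monomial (u - lmExp v φ w ord p) c * p).IsHomogeneous u.degree := by
    intro p k u c hp hpk hle
    have h := (isHomogeneous_monomial c (rfl : (u - lmExp v φ w ord p).degree = _)).mul hpk
    rwa [← degree_eq_of_mem_support hpk (lmExp_mem_support (w := w) (ord := ord) hφ hp), ← map_add,
      tsub_add_cancel_of_le hle] at h
  exact (key _ hf hfd le_sup_left).sub (key _ hg hgd le_sup_right)

theorem lt_level_of_mem_boundedSpan {ℓ : Level ord} (hℓ : ℓ ≠ ⊤)
    (hf : f ∈ boundedSpan G fun p => ℓ < level v w ord p) : ℓ < level v w ord f := by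
  induction hf using AddSubgroup.closure_induction with
  | mem p hp => exact hp.1
  | zero =>
    rw [level_zero]
    exact lt_top_iff_ne_top.2 hℓ
  | add p q _ _ hp hq => exact (lt_min hp hq).trans_le (min_le_level_add _ _)
  | neg p _ hp => rwa [level_neg]

theorem le_level_of_mem_boundedSpan {ℓ : Level ord}
    (hf : f ∈ boundedSpan G fun p => ℓ ≤ level v w ord p) : ℓ ≤ level v w ord f := by
  induction hf using AddSubgroup.closure_induction with
  | mem p hp => exact hp.1
  | zero =>
    rw [level_zero]
    exact le_top
  | add p q _ _ hp hq => exact (le_min hp hq).trans (min_le_level_add _ _)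
  | neg p _ hp => rwa [level_neg]

/-- The `S`-polynomial of `g` and `g'` is a combination of `G` without cancellation of leading
terms. -/
def SPolyReduces (v : AddValuation K (WithTop ℝ)) (φ : Multiplicative (valueGroup v) →* Kˣ)
    (w : Fin n → valueGroup v) (ord : MonomialOrder (Fin n))
    (G : Finset (MvPolynomial (Fin n) K)) (g g' : MvPolynomial (Fin n) K) : Prop :=
  sPoly v φ w ord g g' ∈
    boundedSpan G fun p => level v w ord (sPoly v φ w ord g g') ≤ level v w ord p

/-- Up to terms of larger level, a multiple of `g` can be replaced by any multiple of `g₀` with the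
same leading exponent, the difference being a multiple of an `S`-polynomial. -/
theorem exists_sub_mem_boundedSpan (hφ : IsSplitting v φ)
    (hG : ∀ g ∈ G, g ≠ 0) (hS : ∀ g ∈ G, ∀ g' ∈ G, SPolyReduces v φ w ord G g g')
    {ℓ : Level ord} (hℓ : ℓ ≠ ⊤)
    {g₀ : MvPolynomial (Fin n) K} (hg₀ : g₀ ∈ G) {e₀ : Fin n →₀ ℕ} {c₀ : K}
    (h₀ : level v w ord (monomial e₀ c₀ * g₀) = ℓ)
    (hf : f ∈ boundedSpan G fun p => ℓ ≤ level v w ord p) :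
    ∃ c : K, f - monomial e₀ c * g₀ ∈ boundedSpan G fun p => ℓ < level v w ord p := by
  induction hf using AddSubgroup.closure_induction with
  | zero => exact ⟨0, by simp⟩
  | add p q _ _ hp hq =>
    obtain ⟨c, hc⟩ := hp
    obtain ⟨c', hc'⟩ := hq
    refine ⟨c + c', ?_⟩
    convert add_mem hc hc' using 1
    rw [map_add]
    ring
  | neg p _ hp =>
    obtain ⟨c, hc⟩ := hp
    refine ⟨-c, ?_⟩
    convert neg_mem hc using 1
    rw [map_neg]
    ring
  | mem p hp =>
    obtain ⟨hle, g, hg, e, a, rfl⟩ := hp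
    rcases hle.lt_or_eq with hlt | heq
    · exact ⟨0, by simpa using monomial_mul_mem_boundedSpan hg hlt⟩
    have hg0 := hG g hg
    have hg₀0 := hG g₀ hg₀
    have hl := lc_ne_zero (w := w) (ord := ord) hφ hg0
    have hl₀ := lc_ne_zero (w := w) (ord := ord) hφ hg₀0
    have ha : a ≠ 0 := by
      rintro rfl
      rw [monomial_zero, zero_mul, level_zero] at heq
      exact hℓ heq
    have hu : e + lmExp v φ w ord g = e₀ + lmExp v φ w ord g₀ := by
      refine (termLevel_inj (v := v) (w := w) (ord := ord) (a := a * lc v φ w ord g)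
        (b := c₀ * lc v φ w ord g₀) (mul_ne_zero ha hl) ?_).1
      rw [termLevel_mul, termLevel_mul, termLevel_lc hφ hg0, termLevel_lc hφ hg₀0,
        ← level_monomial_mul, ← level_monomial_mul, h₀, ← heq]
    obtain ⟨m, hm⟩ : ∃ m, m = lmExp v φ w ord g ⊔ lmExp v φ w ord g₀ := ⟨_, rfl⟩
    have hmu : m ≤ e + lmExp v φ w ord g :=
      hm ▸ sup_le le_add_self (hu ▸ le_add_self)
    have hm1 : e + lmExp v φ w ord g - m + (m - lmExp v φ w ord g) = e := by
      rw [tsub_add_tsub_cancel hmu (hm ▸ le_sup_left), add_tsub_cancel_right]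
    have hm2 : e + lmExp v φ w ord g - m + (m - lmExp v φ w ord g₀) = e₀ := by
      rw [tsub_add_tsub_cancel hmu (hm ▸ le_sup_right), hu, add_tsub_cancel_right]
    have hfirst : monomial e a * g = monomial (e + lmExp v φ w ord g - m) (a / lc v φ w ord g₀) *
        (monomial (m - lmExp v φ w ord g) (lc v φ w ord g₀) * g) := by
      rw [← mul_assoc, monomial_mul, hm1, div_mul_cancel₀ _ hl₀]
    refine ⟨a / lc v φ w ord g₀ * lc v φ w ord g, ?_⟩
    have hdiff : monomial e a * g - monomial e₀ (a / lc v φ w ord g₀ * lc v φ w ord g) * g₀ =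
        monomial (e + lmExp v φ w ord g - m) (a / lc v φ w ord g₀) * sPoly v φ w ord g g₀ := by
      rw [sPoly, ← hm, mul_sub, ← hfirst, ← mul_assoc (monomial _ _) (monomial _ _) g₀,
        monomial_mul, hm2]
    rw [hdiff]
    refine monomial_mul_mem_boundedSpan_of_forall (hS g hg g₀ hg₀) fun q hq => ?_
    rw [heq, hfirst, level_monomial_mul, level_monomial_mul _ _ q]
    refine WithTop.add_lt_add_left (termLevel_eq_top.not.2 (div_ne_zero ha hl₀)) ?_
    exact (hm ▸ level_lt_level_sPoly hφ hg0 hg₀0).trans_le hq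

/-- If the leading terms in a representation of `f` cancel, then `f` has a representation whose
terms have larger level. -/
theorem mem_boundedSpan_of_lt_level (hφ : IsSplitting v φ)
    (hG : ∀ g ∈ G, g ≠ 0) (hS : ∀ g ∈ G, ∀ g' ∈ G, SPolyReduces v φ w ord G g g') {ℓ : Level ord}
    (hf : f ∈ boundedSpan G fun p => ℓ ≤ level v w ord p) (hlt : ℓ < level v w ord f) :
    f ∈ boundedSpan G fun p => ℓ < level v w ord p := by
  have hℓ : ℓ ≠ ⊤ := hlt.ne_top
  by_cases hex : ∃ g₀ ∈ G, ∃ e₀ c₀, level v w ord (monomial e₀ c₀ * g₀) = ℓ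
  · obtain ⟨g₀, hg₀, e₀, c₀, h₀⟩ := hex
    obtain ⟨c, hc⟩ := exists_sub_mem_boundedSpan hφ hG hS hℓ hg₀ h₀ hf
    have h1 := lt_level_of_mem_boundedSpan hℓ hc
    have h2 : ℓ < level v w ord (monomial e₀ c * g₀) := by
      have := (lt_min hlt h1).trans_le (min_le_level_sub f (f - monomial e₀ c * g₀))
      rwa [sub_sub_cancel] at this
    rw [← sub_add_cancel f (monomial e₀ c * g₀)]
    exact add_mem hc (monomial_mul_mem_boundedSpan hg₀ h2)
  · push Not at hex
    exact boundedSpan_subset (fun g hg e c h =>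
      monomial_mul_mem_boundedSpan hg (h.lt_of_ne (hex g hg e c).symm)) hf

/-- In an optimal representation of a homogeneous `f` the leading terms cannot cancel, as otherwise
the representation could be improved. Hence one of its terms leads `f`. -/
theorem exists_lmExp_le_of_isHomogeneous (hφ : IsSplitting v φ)
    (hG : IsHomogeneousInput G) (hS : ∀ g ∈ G, ∀ g' ∈ G, SPolyReduces v φ w ord G g g')
    (hf : f.IsHomogeneous d)
    (hfG : f ∈ Ideal.span (G : Set (MvPolynomial (Fin n) K))) (hf0 : f ≠ 0) :
    ∃ g ∈ G, lmExp v φ w ord g ≤ lmExp v φ w ord f := by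
  obtain ⟨c, hc, -, hopt⟩ := exists_optimal_multipliers (size := level v w ord) level_zero
    min_le_level_sub (fun c p q h => by
      rw [← C_mul', ← C_mul', level_C_mul, level_C_mul]
      gcongr) hG hf hfG
  have hterm : ∀ i : multipliers G d, c i • (monomial i.1.2 1 * i.1.1) =
      monomial i.1.2 (c i) * i.1.1 := fun i => by
    rw [← smul_mul_assoc, smul_monomial, smul_eq_mul, mul_one]
  simp only [hterm] at hc hopt
  obtain ⟨ℓ, hℓ⟩ : ∃ ℓ, ℓ = Finset.univ.inf fun i : multipliers G d =>
    level v w ord (monomial i.1.2 (c i) * i.1.1) := ⟨_, rfl⟩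
  have hmem : f ∈ boundedSpan G fun p => ℓ ≤ level v w ord p := by
    rw [← hc]
    refine sum_mem fun i _ => monomial_mul_mem_boundedSpan (mem_multipliers.1 i.2).1 ?_
    rw [hℓ]
    exact Finset.inf_le (Finset.mem_univ i)
  have hle : ¬ ℓ < level v w ord f := by
    intro hlt
    have h := hopt ℓ hlt.ne_top
      (mem_boundedSpan_of_lt_level hφ (fun g hg => (hG g hg).1) hS hmem hlt)
    exact lt_irrefl ℓ (hℓ ▸ (Finset.lt_inf_iff (lt_top_iff_ne_top.2 (hℓ ▸ hlt.ne_top))).2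
      fun i _ => hℓ ▸ h i)
  have heq : ℓ = level v w ord f := le_antisymm (le_level_of_mem_boundedSpan hmem) (not_lt.1 hle)
  have hne : (Finset.univ : Finset (multipliers G d)).Nonempty := by
    by_contra hempty
    rw [Finset.not_nonempty_iff_eq_empty.1 hempty, Finset.sum_empty] at hc
    exact hf0 hc.symm
  obtain ⟨i, -, hi⟩ := Finset.exists_mem_eq_inf Finset.univ hne
    fun i : multipliers G d => level v w ord (monomial i.1.2 (c i) * i.1.1)
  have hiG := (mem_multipliers.1 i.2).1
  refine ⟨i.1.1, hiG, ?_⟩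
  rw [lmExp_eq_of_termLevel_eq hφ hf0 (c := c i * lc v φ w ord i.1.1)
    (u := i.1.2 + lmExp v φ w ord i.1.1)]
  · exact le_add_self
  · rw [termLevel_mul, termLevel_lc hφ (hG _ hiG).1, ← level_monomial_mul, ← hi, ← hℓ, heq]

/-- Buchberger's criterion: if all `S`-polynomials reduce, then the leading monomial of every
element of the ideal is divisible by that of an element of `G`. The homogeneous component of `f`
that contains the leading monomial lies in the ideal and has the same leading monomial. -/
theorem exists_lmExp_le (hφ : IsSplitting v φ)
    (hG : IsHomogeneousInput G) (hS : ∀ g ∈ G, ∀ g' ∈ G, SPolyReduces v φ w ord G g g')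
    (hfG : f ∈ Ideal.span (G : Set (MvPolynomial (Fin n) K))) (hf0 : f ≠ 0) :
    ∃ g ∈ G, lmExp v φ w ord g ≤ lmExp v φ w ord f := by
  obtain ⟨p, hp⟩ : ∃ p, p = homogeneousComponent (lmExp v φ w ord f).degree f := ⟨_, rfl⟩
  have hcoeff : p.coeff (lmExp v φ w ord f) = lc v φ w ord f := by
    rw [hp, coeff_homogeneousComponent, if_pos rfl, lc]
  have hp0 : p ≠ 0 := by
    rintro rfl
    exact lc_ne_zero hφ hf0 (hcoeff.symm.trans (coeff_zero _))
  have hlm : lmExp v φ w ord p = lmExp v φ w ord f := by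
    refine lmExp_eq_of_termLevel_eq hφ hp0 (c := lc v φ w ord f) (le_antisymm ?_ ?_)
    · rw [termLevel_lc hφ hf0, le_level_iff]
      intro u
      rw [hp, coeff_homogeneousComponent]
      split_ifs
      · exact level_le f u
      · simp
    · rw [← hcoeff]
      exact level_le _ _
  rw [← hlm]
  refine exists_lmExp_le_of_isHomogeneous hφ hG hS
    (hp ▸ homogeneousComponent_isHomogeneous _ _) ?_ hp0
  obtain ⟨c, hc, -⟩ := homogeneousComponent_eq_sum_multipliers (Q := fun _ => True) hG
    (lmExp v φ w ord f).degree trivial (fun _ _ _ _ => trivial) (fun _ _ => trivial)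
    (mem_boundedSpan_of_mem_span hfG)
  rw [hp, ← hc]
  refine sum_mem fun i _ => ?_
  rw [← C_mul']
  exact Ideal.mul_mem_left _ _ (Ideal.mul_mem_left _ _
    (Ideal.subset_span (mem_multipliers.1 i.2).1))

end Criterion

/-! ### Initial ideals -/

section InitialIdeal

variable {K : Type*} [Field K] {v : AddValuation K (WithTop ℝ)} {n : ℕ}
  {w : Fin n → valueGroup v} {ord : MonomialOrder (Fin n)}
  {φ : Multiplicative (valueGroup v) →* Kˣ}
  {G : Finset (MvPolynomial (Fin n) K)} {I : Ideal (MvPolynomial (Fin n) K)}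

/-- `w · u` as an element of the value group. -/
def weightOf (w : Fin n → valueGroup v) (u : Fin n →₀ ℕ) : valueGroup v := ∑ i, u i • w i

theorem coe_weightOf (u : Fin n →₀ ℕ) : ((weightOf w u : valueGroup v) : ℝ) = dot v w u := by
  simp only [weightOf, dot, AddSubgroup.val_finsetSum, AddSubgroup.coe_nsmul, nsmul_eq_mul]
  exact Finset.sum_congr rfl fun i _ => mul_comm _ _

/-- The substitution `x_i ↦ t^{-w_i} x_i` from polynomials over the valuation ring. It carries the
polynomials over the valuation ring to those `f` with `trop(f)(w) ≥ 0`. -/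
def twist (φ : Multiplicative (valueGroup v) →* Kˣ) (w : Fin n → valueGroup v) :
    MvPolynomial (Fin n) (valuationRing v) →+* MvPolynomial (Fin n) K :=
  eval₂Hom (C.comp (valuationRing v).subtype)
    fun i => C (φ (Multiplicative.ofAdd (-w i)) : K) * X i

theorem twist_monomial (u : Fin n →₀ ℕ) (a : valuationRing v) :
    twist φ w (monomial u a) =
      monomial u ((φ (Multiplicative.ofAdd (-weightOf w u)) : K) * a) := by
  have h : (φ (Multiplicative.ofAdd (-weightOf w u)) : K) =
      ∏ i, (φ (Multiplicative.ofAdd (-w i)) : K) ^ u i := by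
    rw [weightOf, ← Finset.sum_neg_distrib, ofAdd_sum, map_prod, Units.coe_prod]
    refine Finset.prod_congr rfl fun i _ => ?_
    rw [← smul_neg, ofAdd_nsmul, map_pow, Units.val_pow_eq_pow_val]
  rw [twist, coe_eval₂Hom, eval₂_monomial, Finsupp.prod_fintype _ _ fun i => pow_zero _, h,
    monomial_eq, Finsupp.prod_fintype _ _ fun i => pow_zero _]
  simp only [mul_pow, Finset.prod_mul_distrib, RingHom.comp_apply, C_mul, map_prod, map_pow]
  rw [← mul_assoc, mul_comm (C _) (∏ i, _)]
  rfl

theorem coeff_twist (F : MvPolynomial (Fin n) (valuationRing v)) (u : Fin n →₀ ℕ) :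
    (twist φ w F).coeff u = (φ (Multiplicative.ofAdd (-weightOf w u)) : K) * F.coeff u := by
  classical
  induction F using MvPolynomial.induction_on' with
  | monomial u' a =>
    rw [twist_monomial, coeff_monomial, coeff_monomial]
    split_ifs with h
    · rw [h]
    · simp
  | add p q hp hq => rw [map_add, coeff_add, coeff_add, hp, hq, Subring.coe_add, mul_add]

theorem unit_mul_unit_neg (γ : valueGroup v) :
    (φ (Multiplicative.ofAdd γ) : K) * φ (Multiplicative.ofAdd (-γ)) = 1 := by
  rw [← Units.val_mul, ← map_mul, ← ofAdd_add, add_neg_cancel, ofAdd_zero, map_one, Units.val_one]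

theorem residue_eq_zero_of_ne {a : valuationRing v} (h : v (a : K) ≠ 0) :
    IsLocalRing.residue (valuationRing v) a = 0 := by
  by_contra h'
  exact h ((residue_ne_zero_iff v a).1 h')

/-- Initial forms are reductions of twisted polynomials. -/
theorem exists_twist_of_ne_zero (hφ : IsSplitting v φ)
    {f : MvPolynomial (Fin n) K} (hf : f ≠ 0) :
    ∃ (F : MvPolynomial (Fin n) (valuationRing v)) (c : K), twist φ w F = C c * f ∧
      map (IsLocalRing.residue (valuationRing v)) F = inW v φ w f := by
  classical
  obtain ⟨u₀, hu₀, htrop⟩ := exists_eq_trop (v := v) (w := w) hf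
  have hc₀ := mem_support_iff.1 hu₀
  -- `γ = trop(f)(w)`, which lies in the value group because `w` does
  obtain ⟨γ, hγ⟩ : ∃ γ, γ = val v _ hc₀ + weightOf w u₀ := ⟨_, rfl⟩
  have hγt : ((γ : ℝ) : WithTop ℝ) = trop v w f := by
    rw [← htrop, hγ, AddSubgroup.coe_add, WithTop.coe_add, coe_val, coe_weightOf]
  let t : valueGroup v → K := fun γ => φ (Multiplicative.ofAdd γ)
  have ht : ∀ a b, t (a + b) = t a * t b := fun a b => by
    simp only [t]
    rw [ofAdd_add, map_mul, Units.val_mul]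
  have hval : ∀ u, ((γ : ℝ) : WithTop ℝ) + v (t (-γ + weightOf w u) * f.coeff u) =
      v (f.coeff u) + (dot v w u : WithTop ℝ) := by
    intro u
    have h : v (t (-γ + weightOf w u)) = (((-γ + weightOf w u : valueGroup v) : ℝ) : WithTop ℝ) :=
      hφ _
    rw [v.map_mul, h, ← add_assoc, ← WithTop.coe_add, AddSubgroup.coe_add, AddSubgroup.coe_neg,
      coe_weightOf, add_neg_cancel_left, add_comm]
  have hmem : ∀ u, t (-γ + weightOf w u) * f.coeff u ∈ valuationRing v := by
    intro u
    rw [mem_valuationRing_iff, ← WithTop.add_le_add_iff_left (WithTop.coe_ne_top (a := (γ : ℝ))),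
      hval, add_zero, hγt]
    exact trop_le f u
  let F : MvPolynomial (Fin n) (valuationRing v) :=
    ∑ u ∈ f.support, monomial u ⟨t (-γ + weightOf w u) * f.coeff u, hmem u⟩
  have hF : ∀ u, F.coeff u = ⟨t (-γ + weightOf w u) * f.coeff u, hmem u⟩ := by
    intro u
    simp only [F, coeff_sum, coeff_monomial]
    rw [Finset.sum_ite_eq']
    split_ifs with hu
    · rfl
    · refine Subtype.ext ?_
      change 0 = t (-γ + weightOf w u) * f.coeff u
      rw [notMem_support_iff.1 hu, mul_zero]
  refine ⟨F, t (-γ), MvPolynomial.ext _ _ fun u => ?_, MvPolynomial.ext _ _ fun u => ?_⟩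
  · rw [coeff_twist, hF, coeff_C_mul]
    change t (-weightOf w u) * (t (-γ + weightOf w u) * f.coeff u) = _
    rw [← mul_assoc, ← ht, neg_add_cancel_comm_assoc]
  · rw [coeff_map, hF, coeff_inW]
    split_ifs with h
    · have hc := mem_support_iff.1 h.1
      have hγu : -val v _ hc = -γ + weightOf w u := by
        have h2 := h.2.trans hγt.symm
        rw [← coe_val v hc, ← WithTop.coe_add, WithTop.coe_inj, ← coe_weightOf] at h2
        refine Subtype.ext ?_
        rw [AddSubgroup.coe_neg, AddSubgroup.coe_add, AddSubgroup.coe_neg, ← h2]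
        ring
      have : angular v φ (f.coeff u) = toResidue v (t (-γ + weightOf w u) * f.coeff u) := by
        rw [angular, dif_neg hc, hγu]
      rw [this, toResidue_eq v (hmem u)]
    · refine residue_eq_zero_of_ne fun h0 => h ⟨?_, ?_⟩
      · rw [mem_support_iff]
        intro hc
        change v (t (-γ + weightOf w u) * f.coeff u) = 0 at h0
        rw [hc, mul_zero, v.map_zero] at h0
        exact WithTop.top_ne_zero h0
      · rw [← hval u, ← hγt]
        exact (congrArg _ h0).trans (add_zero _)

/-- A nonzero reduction of a twisted polynomial is its initial form. -/
theorem inW_twist (hφ : IsSplitting v φ)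
    {F : MvPolynomial (Fin n) (valuationRing v)}
    (hF : map (IsLocalRing.residue (valuationRing v)) F ≠ 0) :
    inW v φ w (twist φ w F) = map (IsLocalRing.residue (valuationRing v)) F := by
  have hval : ∀ u, v ((twist φ w F).coeff u) + (dot v w u : WithTop ℝ) =
      v ((F.coeff u : valuationRing v) : K) := by
    intro u
    rw [coeff_twist, v.map_mul, hφ, add_comm, ← add_assoc, ← WithTop.coe_add, AddSubgroup.coe_neg,
      coe_weightOf, add_neg_cancel, WithTop.coe_zero, zero_add]
  have htrop : trop v w (twist φ w F) = 0 := by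
    apply le_antisymm
    · obtain ⟨u, hu⟩ := ne_zero_iff.1 hF
      rw [coeff_map, residue_ne_zero_iff] at hu
      exact (trop_le _ u).trans (by rw [hval, hu])
    · rw [le_trop_iff]
      intro u
      rw [hval]
      exact (mem_valuationRing_iff v).1 (F.coeff u).2
  refine MvPolynomial.ext _ _ fun u => ?_
  rw [coeff_inW, coeff_map, hval, htrop]
  split_ifs with h
  · have hc := mem_support_iff.1 h.1
    have hγu : -val v _ hc = weightOf w u := by
      have h2 := (hval u).trans h.2
      rw [← coe_val v hc, ← WithTop.coe_add, ← WithTop.coe_zero, WithTop.coe_inj,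
        ← coe_weightOf] at h2
      refine Subtype.ext ?_
      rw [AddSubgroup.coe_neg]
      linarith
    have hF' : (φ (Multiplicative.ofAdd (weightOf w u)) : K) * (twist φ w F).coeff u =
        F.coeff u := by
      rw [coeff_twist, ← mul_assoc, unit_mul_unit_neg, one_mul]
    rw [angular, dif_neg hc, hγu, hF', toResidue_eq v (F.coeff u).2]
  · symm
    refine residue_eq_zero_of_ne fun h0 => h ⟨?_, h0⟩
    rw [mem_support_iff]
    intro hc
    have := hval u
    rw [hc, v.map_zero, top_add, h0] at this
    exact WithTop.top_ne_zero this

/-- Every nonzero element of the initial ideal is the initial form of an element of the ideal. -/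
theorem exists_inW_eq_of_mem_initialIdeal (hφ : IsSplitting v φ)
    {q : MvPolynomial (Fin n) (ResidueField v)} (hq : q ∈ initialIdeal v φ w I) (hq0 : q ≠ 0) :
    ∃ f ∈ I, f ≠ 0 ∧ inW v φ w f = q := by
  have hle : initialIdeal v φ w I ≤
      (I.comap (twist φ w)).map (map (IsLocalRing.residue (valuationRing v))) := by
    refine Ideal.span_le.2 ?_
    rintro _ ⟨f, hfI, rfl⟩
    by_cases hf : f = 0
    · rw [hf, inW_zero]
      exact zero_mem _
    · obtain ⟨F, c, hF, hres⟩ := exists_twist_of_ne_zero (w := w) hφ hf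
      rw [← hres]
      refine Ideal.mem_map_of_mem _ ?_
      rw [Ideal.mem_comap, hF]
      exact I.mul_mem_left _ hfI
  obtain ⟨F, hFI, rfl⟩ := (Ideal.mem_map_iff_of_surjective _
    (map_surjective _ IsLocalRing.residue_surjective)).1 (hle hq)
  have h := inW_twist (w := w) hφ hq0
  refine ⟨twist φ w F, hFI, fun h0 => hq0 ?_, h⟩
  rw [← h, h0, inW_zero]

theorem inW_mem_initialIdeal {f : MvPolynomial (Fin n) K} (hf : f ∈ I) :
    inW v φ w f ∈ initialIdeal v φ w I := Ideal.subset_span ⟨f, hf, rfl⟩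

theorem exists_degree_inW_le (hφ : IsSplitting v φ)
    (hlm : ∀ f ∈ I, f ≠ 0 → ∃ g ∈ G, lmExp v φ w ord g ≤ lmExp v φ w ord f)
    {q : MvPolynomial (Fin n) (ResidueField v)} (hq : q ∈ initialIdeal v φ w I) (hq0 : q ≠ 0) :
    ∃ g ∈ G, ord.degree (inW v φ w g) ≤ ord.degree q := by
  obtain ⟨f, hf, hf0, rfl⟩ := exists_inW_eq_of_mem_initialIdeal hφ hq hq0
  exact hlm f hf hf0

theorem span_leadingTerm_inW_eq (hφ : IsSplitting v φ)
    (hG0 : ∀ g ∈ G, g ≠ 0) (hGI : ∀ g ∈ G, g ∈ I)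
    (hlm : ∀ f ∈ I, f ≠ 0 → ∃ g ∈ G, lmExp v φ w ord g ≤ lmExp v φ w ord f) :
    Ideal.span {p | ∃ g ∈ G, p = ord.leadingTerm (inW v φ w g)} =
      leadingIdeal ord (initialIdeal v φ w I) := by
  apply le_antisymm <;> refine Ideal.span_le.2 ?_
  · rintro _ ⟨g, hg, rfl⟩
    exact Ideal.subset_span ⟨_, inW_mem_initialIdeal (hGI g hg), rfl⟩
  · rintro _ ⟨q, hq, rfl⟩
    by_cases hq0 : q = 0
    · rw [hq0, ord.leadingTerm_zero]
      exact zero_mem _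
    obtain ⟨g, hg, hle⟩ := exists_degree_inW_le hφ hlm hq hq0
    have hu : ord.leadingCoeff (inW v φ w g) ≠ 0 :=
      ord.leadingCoeff_ne_zero_iff.2 (inW_ne_zero hφ (hG0 g hg))
    have : ord.leadingTerm q = monomial (ord.degree q - ord.degree (inW v φ w g))
        (ord.leadingCoeff q / ord.leadingCoeff (inW v φ w g)) *
          ord.leadingTerm (inW v φ w g) := by
      rw [MonomialOrder.leadingTerm, MonomialOrder.leadingTerm, monomial_mul,
        tsub_add_cancel_of_le hle, div_mul_cancel₀ _ hu]
    rw [this]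
    exact Ideal.mul_mem_left _ _ (Ideal.subset_span ⟨g, hg, rfl⟩)

/-- Ordinary division over the residue field: a remainder of an element of the initial ideal must
vanish. -/
theorem isGroebnerBasis_of_lmExp_le (hφ : IsSplitting v φ)
    (hG0 : ∀ g ∈ G, g ≠ 0) (hGI : ∀ g ∈ G, g ∈ I)
    (hlm : ∀ f ∈ I, f ≠ 0 → ∃ g ∈ G, lmExp v φ w ord g ≤ lmExp v φ w ord f) :
    IsGroebnerBasis v φ w G I := by
  have hsub : Ideal.span {p | ∃ g ∈ G, p = inW v φ w g} ≤ initialIdeal v φ w I := by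
    refine Ideal.span_le.2 ?_
    rintro _ ⟨g, hg, rfl⟩
    exact inW_mem_initialIdeal (hGI g hg)
  refine le_antisymm (fun q hq => ?_) hsub
  obtain ⟨c, r, hqr, -, hr⟩ := ord.div_set (B := {p | ∃ g ∈ G, p = inW v φ w g}) (by
    rintro _ ⟨g, hg, rfl⟩
    exact (ord.leadingCoeff_ne_zero_iff.2 (inW_ne_zero hφ (hG0 g hg))).isUnit) q
  have hmem : Finsupp.linearCombination _ (fun b : {p | ∃ g ∈ G, p = inW v φ w g} =>
      (b : MvPolynomial (Fin n) (ResidueField v))) c ∈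
        Ideal.span {p | ∃ g ∈ G, p = inW v φ w g} :=
    sum_mem fun b _ => Ideal.mul_mem_left _ _ (Ideal.subset_span b.2)
  by_cases hr0 : r = 0
  · rw [hqr, hr0, add_zero]
    exact hmem
  · have hrI : r ∈ initialIdeal v φ w I := by
      rw [← add_sub_cancel_left (Finsupp.linearCombination _ (fun b : {p | ∃ g ∈ G,
        p = inW v φ w g} => (b : MvPolynomial (Fin n) (ResidueField v))) c) r, ← hqr]
      exact sub_mem hq (hsub hmem)
    obtain ⟨g, hg, hle⟩ := exists_degree_inW_le hφ hlm hrI hr0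
    exact absurd hle (hr _ (ord.degree_mem_support hr0) _ ⟨g, hg, rfl⟩)

end InitialIdeal

/-! ### The Buchberger algorithm -/

section Buchberger

variable {K : Type*} [Field K] {v : AddValuation K (WithTop ℝ)} {n : ℕ}
  {w : Fin n → valueGroup v} {ord : MonomialOrder (Fin n)}
  {φ : Multiplicative (valueGroup v) →* Kˣ}
  {E : MvPolynomial (Fin n) K → MvPolynomial (Fin n) K → ℕ}
  {F : Finset (MvPolynomial (Fin n) K)} {s s' : BState K n}

theorem SPolyReduces.mono {G G' : Finset (MvPolynomial (Fin n) K)} (hG : G ⊆ G')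
    {g g' : MvPolynomial (Fin n) K} (h : SPolyReduces v φ w ord G g g') :
    SPolyReduces v φ w ord G' g g' :=
  boundedSpan_mono hG (fun _ => id) h

theorem SPolyReduces.swap {G : Finset (MvPolynomial (Fin n) K)}
    {g g' : MvPolynomial (Fin n) K} (h : SPolyReduces v φ w ord G g g') :
    SPolyReduces v φ w ord G g' g := by
  rw [SPolyReduces, sPoly_swap, level_neg]
  exact neg_mem h

/-- The invariant of the Buchberger algorithm: every `S`-polynomial of elements of `G` already
reduces, or its pair is still in `P` in one of the two orders. -/
structure BInvariant (v : AddValuation K (WithTop ℝ)) (φ : Multiplicative (valueGroup v) →* Kˣ)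
    (w : Fin n → valueGroup v) (ord : MonomialOrder (Fin n))
    (F : Finset (MvPolynomial (Fin n) K)) (s : BState K n) : Prop where
  input : IsHomogeneousInput s.G
  subset : F ⊆ s.G
  mem_span : ∀ g ∈ s.G, g ∈ Ideal.span (F : Set (MvPolynomial (Fin n) K))
  pairs : ∀ p ∈ s.P, p.1 ∈ s.G ∧ p.2 ∈ s.G
  reduces : ∀ g ∈ s.G, ∀ g' ∈ s.G,
    (g, g') ∈ s.P ∨ (g', g) ∈ s.P ∨ SPolyReduces v φ w ord s.G g g'

theorem BInvariant.init (hF : IsHomogeneousInput F) :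
    BInvariant v φ w ord F (BState.init F) where
  input := hF
  subset := subset_rfl
  mem_span := fun _ hg => Ideal.subset_span hg
  pairs := fun _ hp => Finset.mem_product.1 hp
  reduces := fun _ hg _ hg' => Or.inl (Finset.mem_product.2 ⟨hg, hg'⟩)

theorem BInvariant.exists_isHomogeneous_sPoly (hφ : IsSplitting v φ)
    (h : BInvariant v φ w ord F s) {p : MvPolynomial (Fin n) K × MvPolynomial (Fin n) K}
    (hp : p ∈ s.P) : ∃ d, (sPoly v φ w ord p.1 p.2).IsHomogeneous d := by
  obtain ⟨h1, h2⟩ := h.pairs p hp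
  obtain ⟨h10, d1, hd1⟩ := h.input _ h1
  obtain ⟨h20, d2, hd2⟩ := h.input _ h2
  exact ⟨_, isHomogeneous_sPoly hφ h10 h20 hd1 hd2⟩

theorem BInvariant.alwaysHalts_normalForm (hφ : IsSplitting v φ)
    (hE : EnsuresTermination v φ w ord E) (h : BInvariant v φ w ord F s)
    {p : MvPolynomial (Fin n) K × MvPolynomial (Fin n) K} (hp : p ∈ s.P) :
    AlwaysHalts (NFStep v φ w ord E s.G) NFState.Final
      (NFState.init s.G (sPoly v φ w ord p.1 p.2)) := by
  obtain ⟨d, hd⟩ := h.exists_isHomogeneous_sPoly hφ hp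
  exact hE _ _ d h.input hd

/-- The effect of an iteration in terms of membership: either a pair with remainder zero is
removed, or a new element `r` with its pairs is added. -/
theorem BStep.exists_pair (hs : BStep v φ w ord E s s') :
    ∃ p ∈ s.P,
      (IsNormalForm v φ w ord E s.G (sPoly v φ w ord p.1 p.2) 0 ∧ s'.G = s.G ∧
        ∀ p', p' ∈ s'.P ↔ p' ∈ s.P ∧ p' ≠ p) ∨
      ∃ r ≠ 0, IsNormalForm v φ w ord E s.G (sPoly v φ w ord p.1 p.2) r ∧
        (∀ g, g ∈ s'.G ↔ g = r ∨ g ∈ s.G) ∧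
        ∀ p', p' ∈ s'.P ↔ (p' ∈ s.P ∧ p' ≠ p) ∨ (p'.1 = r ∧ p'.2 ∈ s'.G) := by
  classical
  cases hs with
  | zero p hp hr =>
    refine ⟨p, hp, Or.inl ⟨hr, rfl, fun p' => ?_⟩⟩
    rw [Finset.mem_erase, and_comm]
  | new p hp r hr hr0 =>
    refine ⟨p, hp, Or.inr ⟨r, hr0, hr, fun g => Finset.mem_insert, fun p' => ?_⟩⟩
    rw [Finset.mem_union, Finset.mem_erase, Finset.mem_product, Finset.mem_singleton,
      and_comm (a := p' ≠ p)]

theorem BInvariant.step (hφ : IsSplitting v φ)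
    (h : BInvariant v φ w ord F s) (hs : BStep v φ w ord E s s') :
    BInvariant v φ w ord F s' := by
  obtain ⟨p, hp, hs⟩ := hs.exists_pair
  obtain ⟨d, hd⟩ := h.exists_isHomogeneous_sPoly hφ hp
  -- removing `p` from the pairs is harmless once its `S`-polynomial reduces
  have hreduce : s.G ⊆ s'.G → (∀ p' ∈ s.P, p' ≠ p → p' ∈ s'.P) →
      SPolyReduces v φ w ord s'.G p.1 p.2 → ∀ g ∈ s.G, ∀ g' ∈ s.G,
        (g, g') ∈ s'.P ∨ (g', g) ∈ s'.P ∨ SPolyReduces v φ w ord s'.G g g' := by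
    intro hG' hP' hred g hg g' hg'
    by_cases h1 : (g, g') = p
    · exact Or.inr (Or.inr (by subst h1; exact hred))
    by_cases h2 : (g', g) = p
    · exact Or.inr (Or.inr (by subst h2; exact hred.swap))
    rcases h.reduces g hg g' hg' with h3 | h3 | h3
    · exact Or.inl (hP' _ h3 h1)
    · exact Or.inr (Or.inl (hP' _ h3 h2))
    · exact Or.inr (Or.inr (h3.mono hG'))
  rcases hs with ⟨hr, hG', hP'⟩ | ⟨r, hr0, hr, hG', hP'⟩
  · have hmem := (hr.isPartialDivision hφ h.input hd).mem
    rw [sub_zero, sub_zero, ← hG'] at hmem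
    have hred := hreduce hG'.ge (fun p' h1 h2 => (hP' p').2 ⟨h1, h2⟩) hmem
    have hpairs := fun p' hp' => h.pairs p' ((hP' p').1 hp').1
    rw [← hG'] at hred hpairs
    exact ⟨hG' ▸ h.input, hG' ▸ h.subset, hG' ▸ h.mem_span, hpairs, hred⟩
  · have hdiv := hr.isPartialDivision hφ h.input hd
    have hmem := hdiv.mem
    rw [sub_zero] at hmem
    have hsub : s.G ⊆ s'.G := fun g hg => (hG' g).2 (Or.inr hg)
    have hrG : r ∈ s'.G := (hG' r).2 (Or.inl rfl)
    have hrmem : r ∈ boundedSpan s'.G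
        fun q => level v w ord (sPoly v φ w ord p.1 p.2) ≤ level v w ord q := by
      have h1 : monomial 0 1 * r = r := by rw [monomial_zero', C_1, one_mul]
      rw [← h1]
      refine monomial_mul_mem_boundedSpan hrG ?_
      rw [h1]
      exact hdiv.level_r
    have hpred : SPolyReduces v φ w ord s'.G p.1 p.2 := by
      have := add_mem (boundedSpan_mono hsub (fun _ => id) hmem) hrmem
      rwa [sub_add_cancel] at this
    have hspan : Ideal.span (s.G : Set (MvPolynomial (Fin n) K)) ≤ Ideal.span F :=
      Ideal.span_le.2 h.mem_span
    have hrspan : r ∈ Ideal.span (F : Set (MvPolynomial (Fin n) K)) := by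
      have h1 := hspan (mem_span_of_mem_boundedSpan hmem)
      have h2 : sPoly v φ w ord p.1 p.2 ∈ Ideal.span (F : Set (MvPolynomial (Fin n) K)) :=
        sub_mem (Ideal.mul_mem_left _ _ (h.mem_span _ (h.pairs p hp).1))
          (Ideal.mul_mem_left _ _ (h.mem_span _ (h.pairs p hp).2))
      have h3 := sub_mem h2 h1
      rwa [sub_sub_cancel] at h3
    refine ⟨?_, h.subset.trans hsub, ?_, ?_, ?_⟩
    · intro g hg
      rcases (hG' g).1 hg with rfl | hg
      exacts [⟨hr0, d, hdiv.hom_r⟩, h.input g hg]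
    · intro g hg
      rcases (hG' g).1 hg with rfl | hg
      exacts [hrspan, h.mem_span g hg]
    · intro p' hp'
      rcases (hP' p').1 hp' with hp' | ⟨h1, h2⟩
      · have := h.pairs p' hp'.1
        exact ⟨hsub this.1, hsub this.2⟩
      · exact ⟨h1 ▸ hrG, h2⟩
    · intro g hg g' hg'
      rcases (hG' g).1 hg with rfl | hgs
      · exact Or.inl ((hP' _).2 (Or.inr ⟨rfl, hg'⟩))
      rcases (hG' g').1 hg' with rfl | hgs'
      · exact Or.inr (Or.inl ((hP' _).2 (Or.inr ⟨rfl, hg⟩)))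
      · exact hreduce hsub (fun p' h1 h2 => (hP' p').2 (Or.inl ⟨h1, h2⟩)) hpred g hgs g' hgs'

theorem BInvariant.of_reflTransGen (hφ : IsSplitting v φ)
    (hF : IsHomogeneousInput F)
    (hs : Relation.ReflTransGen (BStep v φ w ord E) (BState.init F) s) :
    BInvariant v φ w ord F s := by
  induction hs with
  | refl => exact .init hF
  | tail _ hst ih => exact ih.step hφ hst

/-- The monomial ideal generated by the leading monomials of `G`; it grows strictly with every new
element of `G`. -/
def lmIdeal (v : AddValuation K (WithTop ℝ)) (φ : Multiplicative (valueGroup v) →* Kˣ)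
    (w : Fin n → valueGroup v) (ord : MonomialOrder (Fin n))
    (G : Finset (MvPolynomial (Fin n) K)) : Ideal (MvPolynomial (Fin n) K) :=
  Ideal.span ((fun u => monomial u (1 : K)) '' (lmExp v φ w ord '' G))

theorem lmIdeal_lt {G G' : Finset (MvPolynomial (Fin n) K)} {r : MvPolynomial (Fin n) K}
    (hG : G ⊆ G') (hrG' : r ∈ G') (hr : ∀ g ∈ G, ¬ lmExp v φ w ord g ≤ lmExp v φ w ord r) :
    lmIdeal v φ w ord G < lmIdeal v φ w ord G' := by
  refine lt_of_le_not_ge (Ideal.span_mono (Set.image_mono (Set.image_mono ?_))) fun hle => ?_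
  · exact Finset.coe_subset.2 hG
  · have hmem : monomial (lmExp v φ w ord r) (1 : K) ∈ lmIdeal v φ w ord G' :=
      Ideal.subset_span ⟨_, ⟨r, Finset.mem_coe.2 hrG', rfl⟩, rfl⟩
    have h := mem_ideal_span_monomial_image.1 (hle hmem) (lmExp v φ w ord r) (by simp)
    obtain ⟨_, ⟨g, hg, rfl⟩, hgr⟩ := h
    exact hr g hg hgr

/-- Each new element enlarges the ideal of leading monomials, and all other steps shrink `P`. -/
theorem alwaysHalts_buchberger (hφ : IsSplitting v φ)
    (hE : EnsuresTermination v φ w ord E) (hF : IsHomogeneousInput F) :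
    AlwaysHalts (BStep v φ w ord E) BState.Final (BState.init F) := by
  refine alwaysHalts_of_measure (BInvariant v φ w ord F) (.init hF)
    (fun s s' h hs => h.step hφ hs) (r := Prod.Lex (· > ·) (· < ·))
    (WellFounded.prod_lex wellFounded_gt wellFounded_lt)
    (fun s => (lmIdeal v φ w ord s.G, s.P.card)) ?_ ?_
  · intro s s' h hs
    obtain ⟨p, hp, ⟨-, hG', hP'⟩ | ⟨r, hr0, hr, hG', -⟩⟩ := hs.exists_pair
    · rw [hG']
      refine Prod.Lex.right _ (Finset.card_lt_card (Finset.ssubset_iff_of_subset ?_ |>.2 ?_))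
      · exact fun p' hp' => ((hP' p').1 hp').1
      · exact ⟨p, hp, fun hp' => ((hP' p).1 hp').2 rfl⟩
    · obtain ⟨d, hd⟩ := h.exists_isHomogeneous_sPoly hφ hp
      exact Prod.Lex.left _ _ (lmIdeal_lt (fun g hg => (hG' g).2 (Or.inr hg))
        ((hG' r).2 (Or.inl rfl))
        ((hr.isPartialDivision hφ h.input hd).irreducible _ (lmExp_mem_support hφ hr0)))
  · intro s h
    rcases s.P.eq_empty_or_nonempty with hP | ⟨p, hp⟩
    · exact Or.inr hP
    · obtain ⟨t, ht, hfin⟩ := (h.alwaysHalts_normalForm hφ hE hp).exists_final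
      by_cases hr : t.cur.r = 0
      · exact Or.inl ⟨_, .zero s p hp ⟨t, ht, hfin, hr⟩⟩
      · exact Or.inl ⟨_, .new s p hp t.cur.r ⟨t, ht, hfin, rfl⟩ hr⟩

theorem BInvariant.exists_lmExp_le (hφ : IsSplitting v φ)
    (h : BInvariant v φ w ord F s) (hfin : s.Final) :
    ∀ f ∈ Ideal.span (F : Set (MvPolynomial (Fin n) K)), f ≠ 0 →
      ∃ g ∈ s.G, lmExp v φ w ord g ≤ lmExp v φ w ord f := by
  intro f hf hf0
  have hP : s.P = ∅ := hfin
  refine ValuedGroebner.exists_lmExp_le hφ h.input (fun g hg g' hg' => ?_)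
    (Ideal.span_mono (Finset.coe_subset.2 h.subset) hf) hf0
  rcases h.reduces g hg g' hg' with h1 | h1 | h1
  · simp [hP] at h1
  · simp [hP] at h1
  · exact h1

end Buchberger
end

end ValuedGroebner

theorem mainTheorem2 {K : Type*} [Field K] (v : AddValuation K (WithTop ℝ))
    (φ : Multiplicative (ValuedGroebner.valueGroup v) →* Kˣ)
    (hφ : ∀ γ : ValuedGroebner.valueGroup v,
      v (φ (Multiplicative.ofAdd γ) : K) = ((γ : ℝ) : WithTop ℝ))
    {n : ℕ} (w : Fin n → ValuedGroebner.valueGroup v) (ord : MonomialOrder (Fin n)) :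
    -- the normal form algorithm halts for the function `E(f, g) = |supp g \ supp f|`
    ValuedGroebner.EnsuresTermination v φ w ord ValuedGroebner.supportEcart ∧
    -- the Buchberger algorithm, for every `E` for which the normal form algorithm halts
    (∀ E : MvPolynomial (Fin n) K → MvPolynomial (Fin n) K → ℕ,
      ValuedGroebner.EnsuresTermination v φ w ord E →
      ∀ F : Finset (MvPolynomial (Fin n) K), ValuedGroebner.IsHomogeneousInput F →
        -- finiteness of the main loop
        ValuedGroebner.AlwaysHalts (ValuedGroebner.BStep v φ w ord E)
          ValuedGroebner.BState.Final (ValuedGroebner.BState.init F) ∧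
        ∀ s : ValuedGroebner.BState K n,
          Relation.ReflTransGen (ValuedGroebner.BStep v φ w ord E)
            (ValuedGroebner.BState.init F) s →
          -- finiteness of every normal form computation that can occur
          (∀ p ∈ s.P, ValuedGroebner.AlwaysHalts (ValuedGroebner.NFStep v φ w ord E s.G)
            ValuedGroebner.NFState.Final
            (ValuedGroebner.NFState.init s.G (ValuedGroebner.sPoly v φ w ord p.1 p.2))) ∧
          -- correctness of the output
          (s.Final →
            (∀ g ∈ s.G, g ∈ Ideal.span (F : Set (MvPolynomial (Fin n) K)) ∧
              ∃ d : ℕ, g.IsHomogeneous d) ∧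
            Ideal.span {p | ∃ g ∈ s.G, p = ord.leadingTerm (ValuedGroebner.inW v φ w g)} =
              ValuedGroebner.leadingIdeal ord (ValuedGroebner.initialIdeal v φ w
                (Ideal.span (F : Set (MvPolynomial (Fin n) K)))) ∧
            ValuedGroebner.IsGroebnerBasis v φ w s.G
              (Ideal.span (F : Set (MvPolynomial (Fin n) K))))) ∧
    -- optimal coefficient vectors exist
    (∀ (m d : ℕ) (x : Fin m → Fin d → K) (β : Fin m → ℝ) (y : Fin d → K),
      y ∈ Submodule.span K (Set.range x) →
      ∃ c : Fin m → K, ∑ i, c i • x i = y ∧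
        ∀ c' : Fin m → K, ∑ i, c' i • x i = y →
          (Finset.univ.inf fun i => v (c' i) + (β i : WithTop ℝ)) ≤
            Finset.univ.inf fun i => v (c i) + (β i : WithTop ℝ)) ∧
    -- optimal representations of homogeneous elements of an ideal exist
    (∀ (G : Finset (MvPolynomial (Fin n) K)) (f : MvPolynomial (Fin n) K) (d : ℕ),
      ValuedGroebner.IsHomogeneousInput G → f.IsHomogeneous d →
      f ∈ Ideal.span (G : Set (MvPolynomial (Fin n) K)) →
      ∃ h : G → MvPolynomial (Fin n) K, ∑ g, h g * g = f ∧
        ∀ h' : G → MvPolynomial (Fin n) K, ∑ g, h' g * g = f →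
          (Finset.univ.inf fun g => ValuedGroebner.trop v w (h' g * g)) ≤
            Finset.univ.inf fun g => ValuedGroebner.trop v w (h g * g)) := by
  refine ⟨ValuedGroebner.ensuresTermination_supportEcart hφ, fun E hE F hF =>
    ⟨ValuedGroebner.alwaysHalts_buchberger hφ hE hF, fun s hs => ?_⟩,
    fun m d x β y hy => ValuedGroebner.exists_optimal_of_mem_span x β hy,
    fun G f d hG hf hfG => ValuedGroebner.exists_optimal_representation ord hφ hG hf hfG⟩
  have h := ValuedGroebner.BInvariant.of_reflTransGen hφ hF hs
  refine ⟨fun p hp => h.alwaysHalts_normalForm hφ hE hp, fun hfin => ?_⟩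
  have hlm := h.exists_lmExp_le hφ hfin
  have hG0 : ∀ g ∈ s.G, g ≠ 0 := fun g hg => (h.input g hg).1
  exact ⟨fun g hg => ⟨h.mem_span g hg, (h.input g hg).2⟩,
    ValuedGroebner.span_leadingTerm_inW_eq hφ hG0 h.mem_span hlm,
    ValuedGroebner.isGroebnerBasis_of_lmExp_le hφ hG0 h.mem_span hlm⟩
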